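/- Let $\mathbb F_8$ be the field with 8 elements, $I=\langle Y^3+X^3Y+X\rangle\subseteq\mathbb F_8[X,Y]$, $I_8=I+\langle X^8-X,\,Y^8-Y\rangle$, and let $\mathbb V(I_8)=\{P_1,\dots,P_n\}\subseteq\mathbb F_8^2$ be the finite variety of $I_8$, with $\mathrm{ev}(F)=(F(P_1),\dots,F(P_n))$. Order the monomials by $X^{i_1}Y^{j_1}\prec_w X^{i_2}Y^{j_2}$ if $2i_1+3j_1<2i_2+3j_2$, or $2i_1+3j_1=2i_2+3j_2$ and $j_1<j_2$. The footprint $\Delta$ is the set of monomials that are not the leading monomial of a nonzero polynomial in $I_8$. For $L\subseteq\Delta$ let $C^\perp(I,L)$ be the dual, for the standard bilinear form on $\mathbb F_8^n$, of the span of $\{\mathrm{ev}(M)\mid M\in L\}$. For $N\in\Delta$ let $\Lambda(N)$ be the set of those $M\in\Delta$ such that for every polynomial $F$ with leading monomial $M$ and support in $\Delta$, $N$ is the leading monomial of some polynomial in $\langle F\rangle+I_8$. Put $$(M_1,\dots,M_{22})=(1,X,Y,X^2,XY,X^3,Y^2,X^2Y,X^4,XY^2,X^3Y,X^5,X^2Y^2,X^4Y,X^6,X^3Y^2,X^5Y,X^7,X^4Y^2,X^6Y,X^5Y^2,X^6Y^2),$$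 $$(\mu(M_1),\dots,\mu(M_{22}))=(1,2,2,3,4,4,3,6,6,6,8,8,9,11,12,12,14,15,15,17,18,21),$$ and let $C(s)=C^\perp(I,\{M_1,\dots,M_s\})$ and $\tilde C(\delta)=C^\perp(I,\{M_i\mid\mu(M_i)<\delta\})$. Then: 1. $\Delta=\{M_1,\dots,M_{22}\}$ and $M_1\prec_w M_2\prec_w\cdots\prec_w M_{22}$. 2. $\#\Lambda(M_i)\ge\mu(M_i)$ for all $i\in\{1,\dots,22\}\setminus\{15,18\}$, while $\#\Lambda(M_{15})\ge 11$ and $\#\Lambda(M_{18})\ge 14$. 3. For every $i\in\{1,\dots,22\}$, every word in $C(i-1)\setminus C(i)$ has Hamming weight at least $\mu(M_i)$. 4. For $(k,d)=(21,2)$, $(19,3)$, $(17,4)$, $(15,6)$, $(12,8)$, $(10,9)$, $(9,11)$, $(8,12)$, $(6,14)$, $(5,15)$, $(3,17)$, $(2,18)$, $(1,21)$, the code $\tilde C(d)$ is an $[22,k,d]_8$ code: it has length $22$, dimension $k$ and minimum distance exactly $d$. 5. The parameters obtained for dual codes from the Klein quartic by Kolluru, Feng and Rao are $[22,k,d]_8$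 with $(k,d)=(21,2)$, $(19,3)$, $(17,4)$, $(15,5)$, $(15,6)$, $(11,7)$, $(10,8)$, $(9,9)$, $(7,10)$, $(6,12)$, $(4,14)$, $(3,15)$, $(2,18)$, $(1,21)$. For each of these pairs $(k,d)$ there is a pair $(k',d')$ in the list of part 4 with $k'\ge k$ and $d'\ge d$, and moreover with $k'>k$ or $d'>d$ whenever $(k,d)$ is not itself in the list of part 4. Conversely, for each of the pairs $(12,8)$, $(10,9)$, $(9,11)$, $(8,12)$, $(6,14)$, $(5,15)$, $(3,17)$ of part 4 there is no pair of Kolluru, Feng and Rao that is at least as large in both entries. -/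

import Mathlib

open MvPolynomial

noncomputable section

namespace AffineVarietyCode

variable {σ F : Type*} [Fintype σ] [Field F] [Fintype F]

/-- The ideal `I_q = I + ⟨X_1^q - X_1, …, X_m^q - X_m⟩`, where `q` is the size of the field. -/
def fieldIdeal (I : Ideal (MvPolynomial σ F)) : Ideal (MvPolynomial σ F) :=
  I ⊔ Ideal.span (Set.range fun s : σ => (X s : MvPolynomial σ F) ^ Fintype.card F - X s)

/-- The finite variety `𝕍(I_q)`; its points are the coordinate positions of the codes. -/
def affineVariety (I : Ideal (MvPolynomial σ F)) : Set (σ → F) :=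
  zeroLocus F (fieldIdeal I)

instance affineVarietyFintype (I : Ideal (MvPolynomial σ F)) : Fintype (affineVariety I) :=
  Fintype.ofFinite _

/-- The evaluation map `F ↦ (F(P))_{P ∈ 𝕍(I_q)}`. -/
def ev (I : Ideal (MvPolynomial σ F)) : MvPolynomial σ F →ₗ[F] (affineVariety I → F) :=
  LinearMap.pi fun P => (aeval P.1).toLinearMap

/-- The footprint of an ideal `J`: the monomials (given by their exponent vectors) which are not
the leading monomial of any (nonzero) polynomial in `J`. -/
def footprint (m : MonomialOrder σ) (J : Ideal (MvPolynomial σ F)) : Set (σ →₀ ℕ) :=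
  {M | ∀ G ∈ J, G ≠ 0 → m.degree G ≠ M}

/-- The primary affine variety code `C(I, L)`, the span of the words `ev(M)`, `M ∈ L`. -/
def primaryCode (I : Ideal (MvPolynomial σ F)) (L : Set (σ →₀ ℕ)) :
    Submodule F (affineVariety I → F) :=
  Submodule.span F ((fun M => ev I (monomial M 1)) '' L)

/-- The dual of a linear code with respect to the standard bilinear form. -/
def dual {ι : Type*} [Fintype ι] (C : Submodule F (ι → F)) : Submodule F (ι → F) where
  carrier := {c | ∀ b ∈ C, ∑ P, c P * b P = 0}
  add_mem' {x y} hx hy b hb := by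
    simp [add_mul, Finset.sum_add_distrib, hx b hb, hy b hb]
  zero_mem' b _ := by simp
  smul_mem' a x hx b hb := by
    simp [mul_assoc, ← Finset.mul_sum, hx b hb]

/-- The dual affine variety code `C^⊥(I, L)`. -/
def dualCode (I : Ideal (MvPolynomial σ F)) (L : Set (σ →₀ ℕ)) :
    Submodule F (affineVariety I → F) :=
  dual (primaryCode I L)

open Classical in
/-- The Hamming weight of a word. -/
def weight {ι : Type*} [Fintype ι] (c : ι → F) : ℕ := hammingNorm c

/-- `C` is a linear code of length `n`, dimension `k` and minimum distance (exactly) `d`. -/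
def HasParameters {ι : Type*} [Fintype ι] (C : Submodule F (ι → F)) (n k d : ℕ) : Prop :=
  Fintype.card ι = n ∧ Module.finrank F C = k ∧
    IsLeast {w : ℕ | ∃ c ∈ C, c ≠ 0 ∧ weight c = w} d

/-- The set `Λ(N)` of those `M` in the footprint of `I_q` such that, for each polynomial `G` with
leading monomial `M` and support in the footprint, `N` is the leading monomial of some polynomial
of the ideal `⟨G⟩ + I_q`. -/
def Lam (m : MonomialOrder σ) (I : Ideal (MvPolynomial σ F)) (N : σ →₀ ℕ) : Set (σ →₀ ℕ) :=
  {M | M ∈ footprint m (fieldIdeal I) ∧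
    ∀ G : MvPolynomial σ F, G ≠ 0 → m.degree G = M →
      (∀ e ∈ G.support, e ∈ footprint m (fieldIdeal I)) →
      ∃ H ∈ Ideal.span {G} ⊔ fieldIdeal I, H ≠ 0 ∧ m.degree H = N}

end AffineVarietyCode

namespace KleinQuartic

/-- Comparison key of the monomial with exponent vector `e = (i, j)`: first `2 i + 3 j`, then `j`,
compared lexicographically. -/
def key (e : Fin 2 →₀ ℕ) : ℕ ×ₗ ℕ := toLex (2 * e 0 + 3 * e 1, e 1)

theorem key_injective : Function.Injective key := by
  intro a b h
  have h' := congrArg ofLex h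
  simp only [key, ofLex_toLex, Prod.mk.injEq] at h'
  ext s
  fin_cases s
  · change a 0 = b 0
    lia
  · exact h'.2

theorem key_add (a b : Fin 2 →₀ ℕ) : key (a + b) = key a + key b := by
  apply ofLex.injective
  refine Prod.ext ?_ rfl
  change 2 * (a 0 + b 0) + 3 * (a 1 + b 1) = (2 * a 0 + 3 * a 1) + (2 * b 0 + 3 * b 1)
  ring

theorem key_le_iff (a b : Fin 2 →₀ ℕ) :
    key a ≤ key b ↔ 2 * a 0 + 3 * a 1 < 2 * b 0 + 3 * b 1 ∨
      (2 * a 0 + 3 * a 1 = 2 * b 0 + 3 * b 1 ∧ a 1 ≤ b 1) := by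
  rw [Prod.Lex.le_iff]
  rfl

theorem key_add_le_add {a b : Fin 2 →₀ ℕ} (h : key a ≤ key b) (c : Fin 2 →₀ ℕ) :
    key (a + c) ≤ key (b + c) := by
  rw [key_add, key_add]
  exact add_le_add_left h _

/-- The exponent vectors of the monomials in `X`, `Y`, ordered by `≺_w`. -/
def WExp : Type := Fin 2 →₀ ℕ

instance : AddCommMonoid WExp := inferInstanceAs (AddCommMonoid (Fin 2 →₀ ℕ))

instance : LinearOrder WExp := LinearOrder.lift' (β := ℕ ×ₗ ℕ) key key_injective

instance : IsOrderedAddMonoid WExp where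
  add_le_add_left _ _ h c := key_add_le_add h c

instance : WellFoundedLT WExp :=
  ⟨InvImage.wf key (wellFounded_lt (α := ℕ ×ₗ ℕ))⟩

/-- The weighted graded order `≺_w` on the monomials in `X`, `Y`. -/
def order : MonomialOrder (Fin 2) where
  syn := WExp
  toSyn :=
    { toFun := fun e => e
      invFun := fun e => e
      left_inv := fun _ => rfl
      right_inv := fun _ => rfl
      map_add' := fun _ _ => rfl }
  toSyn_monotone := by
    intro a b h
    change key a ≤ key b
    have h0 : a 0 ≤ b 0 := h 0
    have h1 : a 1 ≤ b 1 := h 1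
    rw [key_le_iff]
    lia

/-- `X^{i₁} Y^{j₁} ≺_w X^{i₂} Y^{j₂}` if `2 i₁ + 3 j₁ < 2 i₂ + 3 j₂`, or if these weights are equal
and `j₁ < j₂`. -/
theorem order_lt_iff (a b : Fin 2 →₀ ℕ) :
    order.toSyn a < order.toSyn b ↔
      2 * a 0 + 3 * a 1 < 2 * b 0 + 3 * b 1 ∨
        (2 * a 0 + 3 * a 1 = 2 * b 0 + 3 * b 1 ∧ a 1 < b 1) := by
  change key a < key b ↔ _
  rw [Prod.Lex.lt_iff]
  rfl

/-- The exponent vector of `X^i Y^j`. -/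
def expo (i j : ℕ) : Fin 2 →₀ ℕ := Finsupp.single 0 i + Finsupp.single 1 j

/-- The ideal `⟨Y^3 + X^3 Y + X⟩`. -/
def ideal (F : Type*) [Field F] : Ideal (MvPolynomial (Fin 2) F) :=
  Ideal.span {X 1 ^ 3 + X 0 ^ 3 * X 1 + X 0}

/-- The monomials `M_1, …, M_22`; `M_{i+1}` is `mon i`. -/
def mon : Fin 22 → (Fin 2 →₀ ℕ) :=
  ![expo 0 0, expo 1 0, expo 0 1, expo 2 0, expo 1 1, expo 3 0, expo 0 2, expo 2 1,
    expo 4 0, expo 1 2, expo 3 1, expo 5 0, expo 2 2, expo 4 1, expo 6 0, expo 3 2,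
    expo 5 1, expo 7 0, expo 4 2, expo 6 1, expo 5 2, expo 6 2]

/-- The values `μ(M_1), …, μ(M_22)`; `μ(M_{i+1})` is `mu i`. -/
def mu : Fin 22 → ℕ :=
  ![1, 2, 2, 3, 4, 4, 3, 6, 6, 6, 8, 8, 9, 11, 12, 12, 14, 15, 15, 17, 18, 21]

section

variable (F : Type*) [Field F] [Fintype F]

/-- The code `C(s) = C^⊥(I, {M_1, …, M_s})`. -/
def codeC (s : ℕ) : Submodule F (AffineVarietyCode.affineVariety (ideal F) → F) :=
  AffineVarietyCode.dualCode (ideal F) (mon '' {i | (i : ℕ) < s})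

/-- The code `C̃(δ) = C^⊥(I, {M | μ(M) < δ})`. -/
def codeCtilde (δ : ℕ) : Submodule F (AffineVarietyCode.affineVariety (ideal F) → F) :=
  AffineVarietyCode.dualCode (ideal F) (mon '' {i | mu i < δ})

end

/-- The pairs (dimension, minimum distance) of the codes `C̃(δ)`. -/
def params : List (ℕ × ℕ) :=
  [(21, 2), (19, 3), (17, 4), (15, 6), (12, 8), (10, 9), (9, 11), (8, 12), (6, 14), (5, 15),
    (3, 17), (2, 18), (1, 21)]

/-- The pairs (dimension, minimum distance) obtained for dual codes of length 22 from the Klein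
quartic by Kolluru, Feng and Rao. -/
def kfrParams : List (ℕ × ℕ) :=
  [(21, 2), (19, 3), (17, 4), (15, 5), (15, 6), (11, 7), (10, 8), (9, 9), (7, 10), (6, 12),
    (4, 14), (3, 15), (2, 18), (1, 21)]

end KleinQuartic

end

namespace KleinQuartic

section

variable {F : Type*} [Field F] [Fintype F]

/-! ### The coordinate ring of the finite variety -/

/-! Work in `R = F[X, Y] / I_8`. The rules `Y^3 = X^3 Y + X`, `X^8 = X` and `X^7 Y = Y` rewrite any
monomial as a sum of the 22 listed ones without ever going up in the order, so these span `R`; since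
polynomials interpolate, their evaluations span all words, and there are at most 22 points.
Exhibiting 22 points turns both spanning families into bases, and the footprint can be read off
(`range_mon_eq_footprint`).

A word `c` gives the functional `f(G) = ∑ c_P G(P)` and the bilinear form `(G, H) ↦ f(G H)` on `R`,
determined by the values `t` of `f` at the 22 monomials. Let `N` be the first monomial with `t N ≠
0`. An index `M` satisfies `IsLeading` when no polynomial with leading monomial `M` lies in the
radical of the form. If this holds for all `M ∈ S`, no nonzero combination of the monomials in `S`
is in the radical. Since `c · ev(G) = 0` puts `G` in the radical, the words `c · ev(M)`, `M ∈ S`,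
are independent on the support of `c`, and `#S` bounds the weight (`card_le_weight`). If `M` is
leading for every functional starting at `N`, then `M ∈ Λ(N)` by duality (`mon_mem_Lam`).

Divisors of `N` are always leading; further indices come from elimination in the orthogonality
relations. For `X^6` and `X^7` one last index depends on whether the next value of `t` vanishes: it
counts for the weight but is not available for `Λ` (`exists_forall_isLeading`).

Dimensions follow from bijectivity of the syndrome map, and explicit sparse words attain the
distance bounds. -/

theorem charP_two (F : Type*) [Field F] [Fintype F] [Fact (Fintype.card F = 8)] : CharP F 2 :=
  charP_of_card_eq_prime_pow (f := 3) (by simpa using Fact.out (p := Fintype.card F = 8))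

variable (F) in
/-- The ring `F[X, Y] / I_8`. -/
abbrev CoordRing : Type _ :=
  MvPolynomial (Fin 2) F ⧸ AffineVarietyCode.fieldIdeal (ideal F)

variable (F) in
/-- The residue class map onto `F[X, Y] / I_8`. -/
noncomputable abbrev toCoordRing : MvPolynomial (Fin 2) F →ₐ[F] CoordRing F :=
  Ideal.Quotient.mkₐ F _

@[simp] theorem expo_apply_zero (i j : ℕ) : expo i j 0 = i := by simp [expo]

@[simp] theorem expo_apply_one (i j : ℕ) : expo i j 1 = j := by simp [expo]

theorem eq_expo (e : Fin 2 →₀ ℕ) : e = expo (e 0) (e 1) := by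
  ext s
  fin_cases s <;> simp

theorem toCoordRing_monomial_expo (i j : ℕ) :
    toCoordRing F (monomial (expo i j) 1) =
      toCoordRing F (X 0) ^ i * toCoordRing F (X 1) ^ j := by
  rw [← map_pow, ← map_pow, ← map_mul]
  simp [expo, X_pow_eq_monomial, monomial_mul]

/-- The exponents of the footprint monomials. -/
def monExp : Fin 22 → ℕ × ℕ :=
  ![(0, 0), (1, 0), (0, 1), (2, 0), (1, 1), (3, 0), (0, 2), (2, 1), (4, 0), (1, 2), (3, 1),
    (5, 0), (2, 2), (4, 1), (6, 0), (3, 2), (5, 1), (7, 0), (4, 2), (6, 1), (5, 2), (6, 2)]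

theorem mon_eq_expo (b : Fin 22) : mon b = expo (monExp b).1 (monExp b).2 := by
  fin_cases b <;> rfl

variable (F) in
/-- The residue class of the footprint monomial with index `b`. -/
noncomputable def monClass (b : Fin 22) : CoordRing F := toCoordRing F (monomial (mon b) 1)

theorem monClass_eq (b : Fin 22) : monClass F b =
    toCoordRing F (X 0) ^ (monExp b).1 * toCoordRing F (X 1) ^ (monExp b).2 := by
  rw [monClass, mon_eq_expo, toCoordRing_monomial_expo]

variable [Fact (Fintype.card F = 8)]

theorem toCoordRing_X_pow_eight (s : Fin 2) :
    toCoordRing F (X s) ^ 8 = toCoordRing F (X s) := by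
  rw [← map_pow]
  refine Ideal.Quotient.eq.2 (Ideal.mem_sup_right (Ideal.subset_span ⟨s, ?_⟩))
  simp only [Fact.out (p := Fintype.card F = 8)]

theorem coordRing_two_eq_zero : (2 : CoordRing F) = 0 := by
  have := charP_two F
  have h := congrArg (algebraMap F (CoordRing F)) (CharTwo.two_eq_zero (R := F))
  rwa [map_ofNat, map_zero] at h

theorem toCoordRing_Y_pow_three :
    toCoordRing F (X 1) ^ 3 = toCoordRing F (X 0) ^ 3 * toCoordRing F (X 1)
      + toCoordRing F (X 0) := by
  have h : toCoordRing F (X 1 ^ 3 + X 0 ^ 3 * X 1 + X 0) = 0 :=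
    Ideal.Quotient.eq_zero_iff_mem.2 (Ideal.mem_sup_left (Ideal.subset_span rfl))
  simp only [map_add, map_mul, map_pow] at h
  linear_combination h - (toCoordRing F (X 0) ^ 3 * toCoordRing F (X 1)
      + toCoordRing F (X 0)) * coordRing_two_eq_zero (F := F)

/-- In characteristic 2, squaring `y^4 = x^3 y^2 + x y` gives `y^8 = x^6 y^4 + x^2 y^2`.
Substituting for `y^4` again leaves `x^7 y`, while `y^8 = y`. -/
theorem toCoordRing_X_pow_seven_mul_Y :
    toCoordRing F (X 0) ^ 7 * toCoordRing F (X 1) = toCoordRing F (X 1) := by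
  have h3 := toCoordRing_Y_pow_three (F := F)
  have hx := toCoordRing_X_pow_eight (F := F) 0
  have hy := toCoordRing_X_pow_eight (F := F) 1
  have h2 := coordRing_two_eq_zero (F := F)
  generalize toCoordRing F (X 0) = x at *
  generalize toCoordRing F (X 1) = y at *
  have h4 : y ^ 4 = x ^ 3 * y ^ 2 + x * y := by linear_combination y * h3
  have h8 : y ^ 8 = x ^ 6 * y ^ 4 + x ^ 2 * y ^ 2 := by
    linear_combination (y ^ 4 + (x ^ 3 * y ^ 2 + x * y)) * h4 + x ^ 4 * y ^ 3 * h2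
  linear_combination hy - h8 - x ^ 6 * h4 - x * y ^ 2 * hx - x ^ 2 * y ^ 2 * h2

/-- Indices of the footprint monomials `X^i`. -/
def rowZero (i : ℕ) : Fin 22 :=
  [0, 1, 3, 5, 8, 11, 14, 17].getD (if i = 0 then 0 else (i - 1) % 7 + 1) 0

/-- Indices of the footprint monomials `X^i Y`. -/
def rowOne (i : ℕ) : Fin 22 := [2, 4, 7, 10, 13, 16, 19].getD (i % 7) 0

/-- Indices of the footprint monomials `X^i Y^2`. -/
def rowTwo (i : ℕ) : Fin 22 := [6, 9, 12, 15, 18, 20, 21].getD (i % 7) 0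

/-- The indices of the footprint monomials whose sum is congruent to `X^i Y^j` modulo `I_8`. -/
def normalForm : ℕ → ℕ → List (Fin 22)
  | i, 0 => [rowZero i]
  | i, 1 => [rowOne i]
  | i, 2 => [rowTwo i]
  | i, j + 3 => normalForm (i + 3) (j + 1) ++ normalForm (i + 1) j

/-- Pure powers of `X` have period 7 only from exponent 1 on, because `X` vanishes at the origin; in
the rows containing `Y` the period starts at exponent 0. The `getD` defaults are never reached. -/
theorem monExp_rowZero (i : ℕ) :
    monExp (rowZero i) = (if i = 0 then 0 else (i - 1) % 7 + 1, 0) := by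
  have h : ∀ r < 8, monExp ([0, 1, 3, 5, 8, 11, 14, 17].getD r 0) = (r, 0) := by decide
  exact h _ (by split <;> omega)

theorem monExp_rowOne (i : ℕ) : monExp (rowOne i) = (i % 7, 1) := by
  have h : ∀ r < 7, monExp ([2, 4, 7, 10, 13, 16, 19].getD r 0) = (r, 1) := by decide
  exact h _ (Nat.mod_lt _ (by norm_num))

theorem monExp_rowTwo (i : ℕ) : monExp (rowTwo i) = (i % 7, 2) := by
  have h : ∀ r < 7, monExp ([6, 9, 12, 15, 18, 20, 21].getD r 0) = (r, 2) := by decide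
  exact h _ (Nat.mod_lt _ (by norm_num))

theorem pow_mul_eq_of_pow_mul_eq {R : Type*} [Monoid R] {x z : R} {n : ℕ}
    (h : x ^ n * z = z) (i : ℕ) : x ^ i * z = x ^ (i % n) * z := by
  conv_lhs => rw [← Nat.mod_add_div i n, pow_add, pow_mul, mul_assoc]
  congr 1
  induction i / n with
  | zero => simp
  | succ k ih => rw [pow_succ, mul_assoc, h, ih]

theorem sum_normalForm (i j : ℕ) : ((normalForm i j).map (monClass F)).sum =
    toCoordRing F (monomial (expo i j) 1) := by
  rw [toCoordRing_monomial_expo]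
  have h7 := toCoordRing_X_pow_seven_mul_Y (F := F)
  fun_induction normalForm i j with
  | case1 i =>
    simp only [List.map_cons, List.map_nil, List.sum_cons, List.sum_nil, add_zero, monClass_eq,
      monExp_rowZero, pow_zero, mul_one]
    split_ifs with hi
    · rw [hi]
    · obtain ⟨k, rfl⟩ := Nat.exists_eq_succ_of_ne_zero hi
      have h8 : toCoordRing F (X 0) ^ 7 * toCoordRing F (X 0) = toCoordRing F (X 0) := by
        rw [← pow_succ, toCoordRing_X_pow_eight]
      simpa [pow_succ] using (pow_mul_eq_of_pow_mul_eq h8 k).symm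
  | case2 i =>
    simpa [monClass_eq, monExp_rowOne] using (pow_mul_eq_of_pow_mul_eq h7 i).symm
  | case3 i =>
    have h7' : toCoordRing F (X 0) ^ 7 * toCoordRing F (X 1) ^ 2 = toCoordRing F (X 1) ^ 2 := by
      rw [pow_two, ← mul_assoc, h7]
    simpa [monClass_eq, monExp_rowTwo] using (pow_mul_eq_of_pow_mul_eq h7' i).symm
  | case4 i j ih1 ih2 =>
    rw [List.map_append, List.sum_append, ih1, ih2]
    change _ = _ * toCoordRing F (X 1) ^ (j + 3)
    linear_combination -toCoordRing F (X 0) ^ i * toCoordRing F (X 1) ^ j *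
      toCoordRing_Y_pow_three (F := F)

/-- The indices of the footprint monomials whose sum is congruent to `M_j M_k` modulo `I_8`. -/
def prodForm (j k : Fin 22) : List (Fin 22) :=
  normalForm ((monExp j).1 + (monExp k).1) ((monExp j).2 + (monExp k).2)

theorem monClass_mul (j k : Fin 22) :
    monClass F j * monClass F k = ((prodForm j k).map (monClass F)).sum := by
  rw [prodForm, sum_normalForm, toCoordRing_monomial_expo, monClass_eq, monClass_eq]
  ring

/-! ### The footprint monomials and the monomial order -/

theorem toSyn_expo_le_iff (i j k l : ℕ) :
    order.toSyn (expo i j) ≤ order.toSyn (expo k l) ↔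
      2 * i + 3 * j < 2 * k + 3 * l ∨ (2 * i + 3 * j = 2 * k + 3 * l ∧ j ≤ l) := by
  rw [← not_lt, order_lt_iff]
  simp only [expo_apply_zero, expo_apply_one]
  omega

theorem mon_strictMono : StrictMono fun i => order.toSyn (mon i) := by
  have h : ∀ a b : Fin 22, a < b →
      2 * (monExp a).1 + 3 * (monExp a).2 < 2 * (monExp b).1 + 3 * (monExp b).2 ∨
      (2 * (monExp a).1 + 3 * (monExp a).2 = 2 * (monExp b).1 + 3 * (monExp b).2 ∧
        (monExp a).2 < (monExp b).2) := by decide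
  intro a b hab
  simp only [mon_eq_expo]
  rw [order_lt_iff]
  simpa using h a b hab

theorem mon_injective : Function.Injective mon :=
  fun _ _ h => mon_strictMono.injective (congrArg order.toSyn h)

/-- No rewriting rule goes up: `X^3 Y` has the weight 9 of `Y^3` but fewer factors `Y`, `X` has
weight 2, and the other rules lower the exponent of `X`. This makes reduction modulo `I_8`
compatible with leading monomials. -/
theorem toSyn_mon_le_of_mem_normalForm (i j : ℕ) :
    ∀ b ∈ normalForm i j, order.toSyn (mon b) ≤ order.toSyn (expo i j) := by
  fun_induction normalForm i j with
  | case1 i =>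
    simp only [List.mem_singleton, forall_eq, mon_eq_expo, monExp_rowZero, toSyn_expo_le_iff]
    split <;> omega
  | case2 i =>
    simp only [List.mem_singleton, forall_eq, mon_eq_expo, monExp_rowOne, toSyn_expo_le_iff]
    omega
  | case3 i =>
    simp only [List.mem_singleton, forall_eq, mon_eq_expo, monExp_rowTwo, toSyn_expo_le_iff]
    omega
  | case4 i j ih1 ih2 =>
    intro b hb
    rcases List.mem_append.1 hb with hb | hb
    · exact (ih1 b hb).trans ((toSyn_expo_le_iff ..).2 (by omega))
    · exact (ih2 b hb).trans ((toSyn_expo_le_iff ..).2 (by omega))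

theorem normalForm_monExp (b : Fin 22) : normalForm (monExp b).1 (monExp b).2 = [b] := by
  revert b
  decide

end

theorem ne_zero_of_pow_three_eq {F : Type*} [Field F] {α : F} (hα : α ^ 3 = α + 1) : α ≠ 0 := by
  rintro rfl
  simp at hα

section

variable {F : Type*} [Field F] [Fintype F]

/-! ### Evaluation at the points of the finite variety -/

variable (F) in
/-- The evaluation map on `F[X, Y] / I_8`. -/
noncomputable def evClass :
    CoordRing F →ₐ[F] (AffineVarietyCode.affineVariety (ideal F) → F) :=
  Ideal.Quotient.liftₐ _ (AlgHom.pi fun P => aeval P.1) fun f hf => by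
    ext P
    exact P.2 f hf

/-- A word extends by zero to a function on the whole plane, and every function on `F^2` is a
polynomial function. -/
theorem evClass_surjective : Function.Surjective (evClass F) := by
  intro c
  obtain ⟨p, -, hp⟩ : Function.extend Subtype.val c 0 ∈
      (restrictDegree (Fin 2) F (Fintype.card F - 1)).map (evalₗ F (Fin 2)) := by
    rw [map_restrict_dom_evalₗ]
    trivial
  refine ⟨toCoordRing F p, funext fun P => ?_⟩
  have h := congrFun hp P.1
  rw [Subtype.val_injective.extend_apply] at h
  rw [← h]
  rfl

variable [Fact (Fintype.card F = 8)]

/-! ### The points of the finite variety -/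

theorem pow_seven_eq_one {x : F} (hx : x ≠ 0) : x ^ 7 = 1 := by
  simpa [Fact.out (p := Fintype.card F = 8)] using FiniteField.pow_card_sub_one_eq_one x hx

theorem pow_eight_eq_self (x : F) : x ^ 8 = x := by
  simpa [Fact.out (p := Fintype.card F = 8)] using FiniteField.pow_card x

theorem exists_pow_three_eq (F : Type*) [Field F] [Fintype F] [Fact (Fintype.card F = 8)] :
    ∃ α : F, α ^ 3 = α + 1 := by
  classical
  have := charP_two F
  obtain ⟨β, hβ⟩ : ∃ β : F, β ∉ ({0, 1} : Finset F) := by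
    by_contra! h
    have h1 : Fintype.card F ≤ ({0, 1} : Finset F).card :=
      Finset.card_le_card fun x _ => h x
    have h2 := Finset.card_le_two (a := (0 : F)) (b := 1)
    have h3 := Fact.out (p := Fintype.card F = 8)
    omega
  simp only [Finset.mem_insert, Finset.mem_singleton, not_or] at hβ
  have h7 := pow_seven_eq_one hβ.1
  have h2 := CharTwo.two_eq_zero (R := F)
  -- This is the factorisation of `x^7 - 1` over the field with two elements. The two cubics are
  -- reciprocal, so `β` or `β⁻¹` is the required root.
  have hfac : (β - 1) * ((β ^ 3 + β + 1) * (β ^ 3 + β ^ 2 + 1)) = 0 := by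
    linear_combination h7 + (β ^ 4 - β ^ 3) * h2
  rcases mul_eq_zero.1 ((mul_eq_zero.1 hfac).resolve_left (sub_ne_zero.2 hβ.2)) with h | h
  · exact ⟨β, by linear_combination h - (β + 1) * h2⟩
  · refine ⟨β⁻¹, ?_⟩
    have h0 := hβ.1
    field_simp
    linear_combination -h + h2

theorem mem_affineVariety_iff (P : Fin 2 → F) :
    P ∈ AffineVarietyCode.affineVariety (ideal F) ↔
      P 1 ^ 3 + P 0 ^ 3 * P 1 + P 0 = 0 := by
  have hle : AffineVarietyCode.fieldIdeal (ideal F) ≤ RingHom.ker (aeval (R := F) P) ↔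
      P 1 ^ 3 + P 0 ^ 3 * P 1 + P 0 = 0 := by
    rw [AffineVarietyCode.fieldIdeal, ideal, sup_le_iff, Ideal.span_le, Ideal.span_le]
    simp [Set.range_subset_iff, RingHom.mem_ker, Fact.out (p := Fintype.card F = 8),
      pow_eight_eq_self]
  exact hle

section

variable (α : F)

/-- The point `(α^i, α^(2^s + 5 i))`. -/
def curvePoint (i s : ℕ) : Fin 2 → F := ![α ^ i, α ^ (2 ^ s + 5 * i)]

variable {α}

/-- For `x ≠ 0` put `y = x^5 u`. Since `x^7 = 1`, the curve equation becomes `x (u^3 + u + 1) = 0`,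
and the roots `u` are the Frobenius conjugates `α^(2^s)`. Seven values of `x` with three of `u`,
plus the origin, account for 22 points. -/
theorem curvePoint_mem (hα : α ^ 3 = α + 1) (i s : ℕ) :
    curvePoint α i s ∈ AffineVarietyCode.affineVariety (ideal F) := by
  have := charP_two F
  have h2 := CharTwo.two_eq_zero (R := F)
  have h7 := pow_seven_eq_one (ne_zero_of_pow_three_eq hα)
  have hu : (α ^ 2 ^ s) ^ 3 = α ^ 2 ^ s + 1 := by
    rw [← pow_mul, mul_comm, pow_mul, hα, add_pow_char_pow, one_pow]
  have h7i : (α ^ i) ^ 7 = 1 := by rw [← pow_mul, mul_comm, pow_mul, h7, one_pow]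
  rw [mem_affineVariety_iff]
  simp only [curvePoint, Matrix.cons_val_one, Matrix.cons_val_zero, Matrix.cons_val_fin_one,
    pow_add, mul_comm 5 i, pow_mul α i 5]
  generalize α ^ 2 ^ s = u at *
  generalize α ^ i = x at *
  linear_combination x ^ 15 * hu + (x * (u + 1) * (x ^ 7 + 1) + x * u) * h7i + x * (1 + u) * h2

theorem pow_mod_seven_eq (hα : α ^ 3 = α + 1) {m n : ℕ} (h : α ^ m = α ^ n) :
    m % 7 = n % 7 := by
  have h0 := ne_zero_of_pow_three_eq hα
  have h1 : Units.mk0 α h0 ≠ 1 := by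
    intro h
    have := congrArg Units.val h
    simp only [Units.val_mk0, Units.val_one] at this
    simp [this] at hα
  have : Fact (Nat.Prime 7) := ⟨by norm_num⟩
  have ho : orderOf (Units.mk0 α h0) = 7 :=
    orderOf_eq_prime (p := 7) (Units.ext (by simpa using pow_seven_eq_one h0)) h1
  have h2 : Units.mk0 α h0 ^ m = Units.mk0 α h0 ^ n := Units.ext (by simpa using h)
  rw [pow_inj_mod, ho] at h2
  exact h2

theorem curvePoint_injective (hα : α ^ 3 = α + 1) {i i' : Fin 7} {s s' : Fin 3}
    (h : curvePoint α i s = curvePoint α i' s') : i = i' ∧ s = s' := by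
  have h0 := pow_mod_seven_eq hα (congrFun h 0)
  have h1 := pow_mod_seven_eq hα (congrFun h 1)
  have h : ∀ (i i' : Fin 7) (s s' : Fin 3), (i : ℕ) % 7 = i' % 7 →
      (2 ^ (s : ℕ) + 5 * (i : ℕ)) % 7 = (2 ^ (s' : ℕ) + 5 * (i' : ℕ)) % 7 →
      i = i' ∧ s = s' := by decide
  exact h _ _ _ _ h0 h1

theorem card_le_card_affineVariety (F : Type*) [Field F] [Fintype F]
    [Fact (Fintype.card F = 8)] :
    22 ≤ Fintype.card (AffineVarietyCode.affineVariety (ideal F)) := by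
  obtain ⟨α, hα⟩ := exists_pow_three_eq F
  let f : Option (Fin 7 × Fin 3) → AffineVarietyCode.affineVariety (ideal F) := fun o =>
    o.elim ⟨0, by simp [mem_affineVariety_iff]⟩
      fun p => ⟨curvePoint α p.1 p.2, curvePoint_mem hα _ _⟩
  have hne (p : Fin 7 × Fin 3) : curvePoint α p.1 p.2 ≠ 0 := fun h =>
    pow_ne_zero p.1 (ne_zero_of_pow_three_eq hα) (congrFun h 0)
  have hf : Function.Injective f := by
    rintro (_ | p) (_ | q) h
    · rfl
    · exact absurd (congrArg Subtype.val h).symm (hne q)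
    · exact absurd (congrArg Subtype.val h) (hne p)
    · have := curvePoint_injective hα (congrArg Subtype.val h)
      rw [Prod.ext this.1 this.2]
  simpa using Fintype.card_le_of_injective f hf

end

/-! ### The 22 monomials as a basis of the coordinate ring and of the space of words -/

theorem span_monClass : Submodule.span F (Set.range (monClass F)) = ⊤ := by
  rw [eq_top_iff]
  rintro x -
  obtain ⟨f, rfl⟩ := Ideal.Quotient.mkₐ_surjective F _ x
  induction f using MvPolynomial.induction_on' with
  | monomial e a =>
    have h : monomial e a = a • monomial e (1 : F) := by simp [smul_monomial]
    rw [h, map_smul, eq_expo e, ← sum_normalForm]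
    refine Submodule.smul_mem _ _ (list_sum_mem fun y hy => ?_)
    obtain ⟨b, -, rfl⟩ := List.mem_map.1 hy
    exact Submodule.subset_span ⟨b, rfl⟩
  | add p q hp hq =>
    rw [map_add]
    exact Submodule.add_mem _ hp hq

theorem span_evClass_monClass :
    Submodule.span F (Set.range fun b => evClass F (monClass F b)) = ⊤ := by
  have h := congrArg (Submodule.map (evClass F).toLinearMap) (span_monClass (F := F))
  rw [Submodule.map_span, ← Set.range_comp, Submodule.map_top,
    LinearMap.range_eq_top.2 evClass_surjective] at h
  exact h

theorem card_affineVariety (F : Type*) [Field F] [Fintype F] [Fact (Fintype.card F = 8)] :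
    Fintype.card (AffineVarietyCode.affineVariety (ideal F)) = 22 := by
  refine le_antisymm ?_ (card_le_card_affineVariety F)
  have h := finrank_range_le_card (R := F) fun b => evClass F (monClass F b)
  rw [Set.finrank, span_evClass_monClass, finrank_top] at h
  simpa using h

theorem linearIndependent_evClass_monClass :
    LinearIndependent F fun b => evClass F (monClass F b) :=
  linearIndependent_of_top_le_span_of_card_eq_finrank span_evClass_monClass.ge
    (by
    rw [Module.finrank_fintype_fun_eq_card, card_affineVariety, Fintype.card_fin])

theorem linearIndependent_monClass : LinearIndependent F (monClass F) :=
  LinearIndependent.of_comp (evClass F).toLinearMap linearIndependent_evClass_monClass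

variable (F) in
/-- The footprint monomials form a basis of `F[X, Y] / I_8`. -/
noncomputable def monBasis : Module.Basis (Fin 22) F (CoordRing F) :=
  Module.Basis.mk linearIndependent_monClass span_monClass.ge

@[simp] theorem monBasis_apply (b : Fin 22) : monBasis F b = monClass F b :=
  Module.Basis.mk_apply ..

variable (F) in
/-- The evaluated footprint monomials form a basis of the space of all words. -/
noncomputable def evBasis :
    Module.Basis (Fin 22) F (AffineVarietyCode.affineVariety (ideal F) → F) :=
  Module.Basis.mk linearIndependent_evClass_monClass span_evClass_monClass.ge

theorem evBasis_apply (b : Fin 22) :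
    evBasis F b = AffineVarietyCode.ev (ideal F) (monomial (mon b) 1) :=
  Module.Basis.mk_apply ..

/-! ### Leading monomials modulo `I_8` -/

theorem repr_toCoordRing_monomial (e : Fin 2 →₀ ℕ) (a : F) (b : Fin 22) :
    (monBasis F).repr (toCoordRing F (monomial e a)) b =
      a * ((normalForm (e 0) (e 1)).count b : F) := by
  have h : monomial e a = a • monomial (expo (e 0) (e 1)) (1 : F) := by
    rw [← eq_expo]; simp [smul_monomial]
  rw [h, map_smul, ← sum_normalForm, map_smul, Finsupp.smul_apply, smul_eq_mul]
  congr 1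
  induction normalForm (e 0) (e 1) with
  | nil => simp
  | cons c l ih =>
    rw [List.map_cons, List.sum_cons, map_add, Finsupp.add_apply, ih, ← monBasis_apply,
      Module.Basis.repr_self, List.count_cons, Finsupp.single_apply]
    by_cases h : c = b <;> simp [h, add_comm]

theorem repr_toCoordRing (f : MvPolynomial (Fin 2) F) (b : Fin 22) :
    (monBasis F).repr (toCoordRing F f) b =
      ∑ e ∈ f.support, f.coeff e * ((normalForm (e 0) (e 1)).count b : F) := by
  conv_lhs => rw [f.as_sum]
  rw [map_sum, map_sum, Finsupp.finsetSum_apply]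
  exact Finset.sum_congr rfl fun e _ => repr_toCoordRing_monomial _ _ _

theorem count_normalForm_eq_zero {e : Fin 2 →₀ ℕ} {b : Fin 22}
    (h : order.toSyn e < order.toSyn (mon b)) : (normalForm (e 0) (e 1)).count b = 0 := by
  rw [List.count_eq_zero]
  intro hb
  have := toSyn_mon_le_of_mem_normalForm _ _ b hb
  rw [← eq_expo] at this
  exact absurd h this.not_gt

theorem repr_toCoordRing_of_degree_lt {f : MvPolynomial (Fin 2) F} {b : Fin 22}
    (h : order.toSyn (order.degree f) < order.toSyn (mon b)) :
    (monBasis F).repr (toCoordRing F f) b = 0 := by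
  rw [repr_toCoordRing]
  refine Finset.sum_eq_zero fun e he => ?_
  rw [count_normalForm_eq_zero ((order.le_degree he).trans_lt h)]
  simp

/-- The leading monomial is its own normal form, and all other terms reduce to strictly smaller
basis monomials, so nothing can cancel the leading coefficient. -/
theorem repr_toCoordRing_of_degree_eq {f : MvPolynomial (Fin 2) F} {b : Fin 22}
    (h : order.degree f = mon b) :
    (monBasis F).repr (toCoordRing F f) b = order.leadingCoeff f := by
  rw [repr_toCoordRing, Finset.sum_eq_single (mon b)]
  · rw [MonomialOrder.leadingCoeff, h, mon_eq_expo]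
    simp [normalForm_monExp]
  · intro e he hne
    rw [count_normalForm_eq_zero]
    · simp
    · rw [← h]
      refine (order.le_degree he).lt_of_ne fun h' => hne ?_
      rw [← h]
      exact order.toSyn.injective h'
  · intro hb
    rw [notMem_support_iff.1 hb, zero_mul]

theorem range_mon_eq_footprint : Set.range mon =
    AffineVarietyCode.footprint order (AffineVarietyCode.fieldIdeal (ideal F)) := by
  ext M
  constructor
  · rintro ⟨b, rfl⟩ G hG hG0 hdeg
    have h := repr_toCoordRing_of_degree_eq hdeg
    rw [show toCoordRing F G = 0 from Ideal.Quotient.eq_zero_iff_mem.2 hG] at h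
    exact hG0 (order.leadingCoeff_eq_zero_iff.1 (by simpa using h.symm))
  · intro hM
    by_contra hr
    -- If `M` is not among the 22 monomials, subtracting its normal form gives an element of `I_8`
    -- with leading monomial `M`.
    let R : MvPolynomial (Fin 2) F :=
      ((normalForm (M 0) (M 1)).map fun b => monomial (mon b) (1 : F)).sum
    have hlt : ∀ e ∈ R.support, order.toSyn e < order.toSyn M := by
      intro e he
      have : ∃ b ∈ normalForm (M 0) (M 1), e = mon b := by
        by_contra! hne
        refine mem_support_iff.1 he ?_
        have hc : R.coeff e = ((normalForm (M 0) (M 1)).map fun b =>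
            coeff e (monomial (mon b) (1 : F))).sum := by
          rw [← coeffAddMonoidHom_apply, map_list_sum, List.map_map]
          rfl
        rw [hc]
        refine List.sum_eq_zero fun y hy => ?_
        obtain ⟨b, hb, rfl⟩ := List.mem_map.1 hy
        rw [coeff_monomial, if_neg (hne b hb).symm]
      obtain ⟨b, hb, rfl⟩ := this
      have hle := toSyn_mon_le_of_mem_normalForm _ _ b hb
      rw [← eq_expo] at hle
      exact hle.lt_of_ne fun h => hr ⟨b, order.toSyn.injective h⟩
    have hMR : R.coeff M = 0 := by
      by_contra h
      exact lt_irrefl _ (hlt M (mem_support_iff.2 h))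
    have hcoeff : (monomial M 1 - R).coeff M ≠ 0 := by simp [hMR]
    refine hM (monomial M 1 - R) ?_ (fun h => hcoeff (by rw [h, coeff_zero])) ?_
    · rw [← Ideal.Quotient.eq_zero_iff_mem]
      change toCoordRing F _ = 0
      rw [map_sub, map_list_sum, List.map_map, sub_eq_zero]
      have := sum_normalForm (F := F) (M 0) (M 1)
      rw [← eq_expo] at this
      exact this.symm
    · refine order.toSyn.injective (le_antisymm (order.degree_le_iff.2 fun e he => ?_)
        (order.le_degree (mem_support_iff.2 hcoeff)))
      by_cases heM : e = M
      · rw [heM]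
      · refine (hlt e (mem_support_iff.2 fun h => mem_support_iff.1 he ?_)).le
        rw [coeff_sub, coeff_monomial, if_neg (Ne.symm heM), h, sub_zero]

end

/-! ### Leading indices of a functional -/

section

variable {F : Type*} [Field F]

/-- The value at `M_j M_k` of the functional with values `t` at the footprint monomials. -/
def pairing (t : Fin 22 → F) (j k : Fin 22) : F := ((prodForm j k).map t).sum

/-- No polynomial with leading monomial `M` is orthogonal to all footprint monomials, for the
bilinear form attached to the functional with values `t` at the footprint monomials. -/
def IsLeading (t : Fin 22 → F) (M : Fin 22) : Prop :=
  ∀ a : Fin 22 → F, a M = 1 → (∀ j, M < j → a j = 0) → ¬ ∀ k, ∑ j, a j * pairing t j k = 0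

/-- Otherwise, dividing by the coefficient at the largest index of the support of `a`, which lies in
`S`, contradicts `IsLeading` there. -/
theorem eq_zero_of_forall_isLeading {t : Fin 22 → F} {S : Finset (Fin 22)}
    (hS : ∀ M ∈ S, IsLeading t M) {a : Fin 22 → F} (ha : ∀ j ∉ S, a j = 0)
    (h : ∀ k, ∑ j, a j * pairing t j k = 0) : a = 0 := by
  classical
  by_contra hne
  obtain ⟨j, hj⟩ := Function.ne_iff.1 hne
  let T : Finset (Fin 22) := {j | a j ≠ 0}
  have hT : T.Nonempty := ⟨j, by simpa [T] using hj⟩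
  have hM : a (T.max' hT) ≠ 0 := by simpa [T] using T.max'_mem hT
  refine hS (T.max' hT) (by_contra fun h => hM (ha _ h)) (fun j => (a (T.max' hT))⁻¹ * a j)
    (inv_mul_cancel₀ hM) (fun j hj => ?_) fun k => ?_
  · have : j ∉ T := fun h => absurd (T.le_max' j h) hj.not_ge
    rw [show a j = 0 by simpa [T] using this, mul_zero]
  · simp only [mul_assoc]
    rw [← Finset.mul_sum, h, mul_zero]

/-- The pairs `(j, b)` with `j ≤ M` and `N ≤ b` such that `M_b` is a term of `M_j M_k`. -/
def relationTerms (N M k : Fin 22) : List (Fin 22 × Fin 22) :=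
  (List.finRange 22).flatMap fun j =>
    if j ≤ M then ((prodForm j k).filter (N ≤ ·)).map (Prod.mk j) else []

theorem sum_mul_pairing {t a : Fin 22 → F} {N M : Fin 22} (ht : ∀ j < N, t j = 0)
    (ha : ∀ j, M < j → a j = 0) (k : Fin 22) :
    ∑ j, a j * pairing t j k = ((relationTerms N M k).map fun p => a p.1 * t p.2).sum := by
  rw [relationTerms, List.map_flatMap, List.flatMap_def, List.sum_flatten, List.map_map,
    Fin.sum_univ_def]
  congr 1
  refine List.map_congr_left fun j _ => ?_
  simp only [Function.comp_apply]
  split_ifs with hj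
  · rw [pairing, List.map_map, ← List.sum_map_mul_left]
    induction prodForm j k with
    | nil => rfl
    | cons b l ih =>
      by_cases hb : N ≤ b
      · simpa [hb] using ih
      · simpa [hb, ht b (not_le.1 hb)] using ih
  · rw [ha j (not_le.1 hj), zero_mul]
    rfl

/-- Only indices `j ≤ M` and values `t b` with `N ≤ b` survive, so each orthogonality relation is a
short sum. Separating `l` from `relationTerms` lets a relation be supplied as a literal list and
certified by `decide`. -/
theorem isLeading_of_relations {t : Fin 22 → F} {N M : Fin 22}
    (ht : ∀ j < N, t j = 0)
    (H : ∀ a : Fin 22 → F, a M = 1 →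
      (∀ k l, relationTerms N M k = l → (l.map fun p => a p.1 * t p.2).sum = 0) → False) :
    IsLeading t M := fun a haM ha h =>
  H a haM fun k l hl => by rw [← hl, ← sum_mul_pairing ht ha, h]

/-- If `M_M M_K = M_N`, then pairing with `M_K` isolates the leading term: smaller `M_j` give
products below `M_N`, where `t` vanishes. -/
theorem isLeading_of_add_eq {t : Fin 22 → F} {N M K : Fin 22} (htN : t N = 1)
    (ht : ∀ j < N, t j = 0) (h : monExp M + monExp K = monExp N) : IsLeading t M := by
  intro a haM ha hk
  have hK : ∑ j, a j * pairing t j K = 1 := by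
    rw [Finset.sum_eq_single M]
    · simp only [haM, one_mul, pairing, prodForm]
      rw [← Prod.fst_add, ← Prod.snd_add, h, normalForm_monExp]
      simpa using htN
    · intro j _ hj
      rcases hj.lt_or_gt with hj | hj
      · refine mul_eq_zero_of_right _ (List.sum_eq_zero fun y hy => ?_)
        obtain ⟨b, hb, rfl⟩ := List.mem_map.1 hy
        refine ht b (mon_strictMono.lt_iff_lt.1 ?_)
        refine (toSyn_mon_le_of_mem_normalForm _ _ b hb).trans_lt ?_
        have hlt : order.toSyn (mon j) < order.toSyn (mon M) := mon_strictMono hj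
        simp only [mon_eq_expo N, ← h, mon_eq_expo j, mon_eq_expo M, order_lt_iff, expo_apply_zero,
          expo_apply_one, Prod.fst_add, Prod.snd_add] at hlt ⊢
        omega
      · rw [ha j hj, zero_mul]
    · simp
  rw [hk] at hK
  exact zero_ne_one hK

end

section

/-! ### From leading indices to Hamming weights and to the sets `Λ(N)` -/

variable {F : Type*} [Field F] [Fintype F] [Fact (Fintype.card F = 8)]

theorem map_mul_monClass (f : CoordRing F →ₗ[F] F) (x : CoordRing F) (k : Fin 22) :
    f (x * monClass F k) =
      ∑ j, (monBasis F).repr x j * pairing (fun b => f (monClass F b)) j k := by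
  conv_lhs => rw [← (monBasis F).sum_repr x, Finset.sum_mul, map_sum]
  refine Finset.sum_congr rfl fun j _ => ?_
  rw [smul_mul_assoc, map_smul, monBasis_apply, monClass_mul, map_list_sum, List.map_map]
  rfl

theorem card_le_weight {c : AffineVarietyCode.affineVariety (ideal F) → F} {t : Fin 22 → F}
    {S : Finset (Fin 22)} {γ : F}
    (ht : ∀ b, t b = γ * ∑ P, c P * AffineVarietyCode.ev (ideal F) (monomial (mon b) 1) P)
    (hS : ∀ M ∈ S, IsLeading t M) : S.card ≤ AffineVarietyCode.weight c := by
  classical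
  -- These are `#S` vectors in a space whose dimension is the weight of `c`; a dependence among them
  -- yields an `x` with `c · ev(x) = 0`, which is then in the radical.
  let v : S → {P // c P ≠ 0} → F := fun j P => c P * evClass F (monClass F j) P
  have hv : LinearIndependent F v := by
    rw [Fintype.linearIndependent_iff]
    intro g hg
    let a : Fin 22 → F := fun j => if h : j ∈ S then g ⟨j, h⟩ else 0
    let x : CoordRing F := ∑ j, a j • monClass F j
    have hx (P) : c P * evClass F x P = 0 := by
      by_cases hP : c P = 0
      · rw [hP, zero_mul]
      · have h := congrFun hg ⟨P, hP⟩
        rw [Finset.sum_apply] at h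
        simp only [Pi.smul_apply, smul_eq_mul, Pi.zero_apply, v] at h
        rw [← h]
        simp only [x, map_sum, Finset.sum_apply, map_smul, Pi.smul_apply, smul_eq_mul,
          Finset.mul_sum]
        rw [← Finset.sum_subset (Finset.subset_univ S), ← Finset.sum_attach]
        · refine Finset.sum_congr rfl fun j _ => ?_
          simp only [a, j.2, dif_pos]
          ring
        · intro j _ hj
          simp [a, hj]
    let f : CoordRing F →ₗ[F] F :=
      γ • (∑ P, c P • LinearMap.proj P) ∘ₗ (evClass F).toLinearMap
    have hf (y) : f y = γ * ∑ P, c P * evClass F y P := by simp [f]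
    have hft : (fun b => f (monClass F b)) = t := by
      ext b
      rw [hf, ht]
      rfl
    have hxa (j) : (monBasis F).repr x j = a j := by
      simp only [x, ← monBasis_apply]
      rw [Module.Basis.repr_sum_self]
    have ha : a = 0 := by
      refine eq_zero_of_forall_isLeading hS (fun j hj => by simp [a, hj]) fun k => ?_
      have h := map_mul_monClass f x k
      simp only [hxa, hft] at h
      rw [← h, hf]
      refine mul_eq_zero_of_right _ (Finset.sum_eq_zero fun P _ => ?_)
      rw [map_mul, Pi.mul_apply, ← mul_assoc, hx, zero_mul]
    intro j
    have h := congrFun ha j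
    simpa [a] using h
  have h := hv.fintype_card_le_finrank
  rw [Module.finrank_fintype_fun_eq_card, Fintype.card_coe, Fintype.card_subtype] at h
  exact h

/-- If `M_N` were outside `⟨G⟩` plus the span of the smaller basis monomials, some functional would
kill that sum but not `M_N`. After scaling it starts at `N` and has `G` in its radical, against the
hypothesis. So `M_N` is congruent to `u + w` with `u` in `⟨G⟩` and `w` smaller, and `u` has leading
monomial `M_N`. -/
theorem mon_mem_Lam {N M : Fin 22}
    (h : ∀ t : Fin 22 → F, t N = 1 → (∀ j < N, t j = 0) → IsLeading t M) :
    mon M ∈ AffineVarietyCode.Lam order (ideal F) (mon N) := by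
  refine ⟨range_mon_eq_footprint (F := F) ▸ ⟨M, rfl⟩, fun G hG hdeg _ => ?_⟩
  let U : Submodule F (CoordRing F) :=
    (Ideal.span {toCoordRing F G}).restrictScalars F
  let W : Submodule F (CoordRing F) := Submodule.span F (monClass F '' {j | j < N})
  have hU : monClass F N ∈ U ⊔ W := by
    by_contra hnot
    obtain ⟨f, hfN, hf⟩ := Submodule.exists_le_ker_of_notMem hnot
    let g : CoordRing F →ₗ[F] F := (f (monClass F N))⁻¹ • f
    have hg : U ⊔ W ≤ LinearMap.ker g := fun y hy => by
      simp [g, show f y = 0 from hf hy]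
    refine h (fun b => g (monClass F b)) (by simp [g, hfN])
      (fun j hj => hg (Submodule.mem_sup_right (Submodule.subset_span ⟨j, hj, rfl⟩)))
      (fun j => (order.leadingCoeff G)⁻¹ * (monBasis F).repr (toCoordRing F G) j) ?_ ?_ ?_
    · rw [repr_toCoordRing_of_degree_eq hdeg]
      exact inv_mul_cancel₀ (order.leadingCoeff_ne_zero_iff.2 hG)
    · intro j hj
      rw [repr_toCoordRing_of_degree_lt, mul_zero]
      rw [hdeg]
      exact mon_strictMono hj
    · intro k
      simp only [mul_assoc]
      rw [← Finset.mul_sum, ← map_mul_monClass]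
      refine mul_eq_zero_of_right _ (hg (Submodule.mem_sup_left ?_))
      exact Ideal.mul_mem_right _ _ (Ideal.mem_span_singleton_self _)
  obtain ⟨u, hu, w, hw, huw⟩ := Submodule.mem_sup.1 hU
  have hrepr (j) (hj : N ≤ j) : (monBasis F).repr u j = if j = N then 1 else 0 := by
    have hwj : (monBasis F).repr w j = 0 := by
      refine Submodule.span_induction (p := fun w _ => (monBasis F).repr w j = 0)
        ?_ (by simp) (fun x y _ _ hx hy => by simp [hx, hy]) (fun a x _ hx => by simp [hx]) hw
      rintro _ ⟨i, hi, rfl⟩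
      rw [← monBasis_apply, Module.Basis.repr_self, Finsupp.single_apply,
        if_neg (hi.trans_le hj).ne]
    have := congrArg (fun y => (monBasis F).repr y j) huw
    simp only [map_add, Finsupp.add_apply, hwj, add_zero] at this
    rw [this, ← monBasis_apply, Module.Basis.repr_self, Finsupp.single_apply]
    simp only [eq_comm]
  -- The reduced representative of `u`: its support lies in the footprint, so its degree is visible
  -- from the coordinates of `u`.
  let H : MvPolynomial (Fin 2) F := ∑ j, monomial (mon j) ((monBasis F).repr u j)
  have hHu : toCoordRing F H = u := by
    conv_rhs => rw [← (monBasis F).sum_repr u]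
    rw [map_sum]
    refine Finset.sum_congr rfl fun j _ => ?_
    rw [monBasis_apply, monClass, ← map_smul, smul_monomial, smul_eq_mul, mul_one]
  have hHN : H.coeff (mon N) = 1 := by
    simp only [H, coeff_sum, coeff_monomial, mon_injective.eq_iff]
    rw [Finset.sum_ite_eq' Finset.univ N, if_pos (Finset.mem_univ _), hrepr N le_rfl, if_pos rfl]
  refine ⟨H, ?_, fun h0 => by simp [h0] at hHN, ?_⟩
  · rw [← Ideal.mem_quotient_iff_mem_sup, Ideal.map_span, Set.image_singleton]
    change toCoordRing F H ∈ _
    rw [hHu]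
    exact hu
  · refine order.toSyn.injective (le_antisymm (order.degree_le_iff.2 fun e he => ?_)
      (order.le_degree (mem_support_iff.2 (by simp [hHN]))))
    by_contra hlt
    refine mem_support_iff.1 he ?_
    simp only [H, coeff_sum, coeff_monomial]
    refine Finset.sum_eq_zero fun j _ => ?_
    split_ifs with hj
    · subst hj
      have hNj : N < j := mon_strictMono.lt_iff_lt.1 (not_le.1 hlt)
      rw [hrepr j hNj.le, if_neg hNj.ne']
    · rfl

end

/-! ### Leading indices beyond the divisors -/

section

variable {F : Type*} [Field F] [CharP F 2]

/-- The pattern of all these lemmas: suppose `Y + a₁ X + a₀` is in the radical. Its products with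
`X^3` and `Y^2` share the term `X^3 Y`, since `Y^3 = X^3 Y + X`; together with `t 9 = 0` from `h4`
this forces `a₁ = 0`. The pair `h8`, `h9` likewise gives `a₀ = 0`. Finally `X^3 Y^3 = X^6 Y + X^4`,
with `t 19 = 0` from `h14`, gives `t 8 = 0`, a contradiction. -/
theorem isLeading_X4_Y {t : Fin 22 → F} (htN : t 8 = 1) (ht : ∀ j < 8, t j = 0) :
    IsLeading t 2 := by
  refine isLeading_of_relations ht fun a haM h => ?_
  have h4 := h 4 [(2, 9)] (by decide)
  have h5 := h 5 [(1, 8), (2, 10)] (by decide)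
  have h6 := h 6 [(1, 9), (2, 10)] (by decide)
  have h8 := h 8 [(0, 8), (1, 11), (2, 13)] (by decide)
  have h9 := h 9 [(0, 9), (1, 12), (2, 13)] (by decide)
  have h14 := h 14 [(0, 14), (1, 17), (2, 19)] (by decide)
  have h15 := h 15 [(0, 15), (1, 18), (2, 19), (2, 8)] (by decide)
  simp only [List.map_cons, List.map_nil, List.sum_cons, List.sum_nil, haM, htN]
    at h4 h5 h6 h8 h9 h14 h15
  grind

theorem isLeading_X5_Y {t : Fin 22 → F} (htN : t 11 = 1) (ht : ∀ j < 11, t j = 0) :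
    IsLeading t 2 := by
  refine isLeading_of_relations ht fun a haM h => ?_
  have h7 := h 7 [(2, 12)] (by decide)
  have h8 := h 8 [(1, 11), (2, 13)] (by decide)
  have h9 := h 9 [(1, 12), (2, 13)] (by decide)
  have h13 := h 13 [(0, 13), (1, 16), (2, 18)] (by decide)
  have h18 := h 18 [(0, 18), (1, 20), (2, 11)] (by decide)
  simp only [List.map_cons, List.map_nil, List.sum_cons, List.sum_nil, haM, htN]
    at h7 h8 h9 h13 h18
  grind

theorem isLeading_X5_XY {t : Fin 22 → F} (htN : t 11 = 1) (ht : ∀ j < 11, t j = 0) :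
    IsLeading t 4 := by
  refine isLeading_of_relations ht fun a haM h => ?_
  have h4 := h 4 [(4, 12)] (by decide)
  have h5 := h 5 [(3, 11), (4, 13)] (by decide)
  have h6 := h 6 [(3, 12), (4, 13)] (by decide)
  have h7 := h 7 [(2, 12), (3, 13), (4, 15)] (by decide)
  have h8 := h 8 [(1, 11), (2, 13), (3, 14), (4, 16)] (by decide)
  have h9 := h 9 [(1, 12), (2, 13), (3, 15), (4, 16)] (by decide)
  have h12 := h 12 [(0, 12), (1, 15), (2, 16), (3, 18), (4, 19)] (by decide)
  have h15 := h 15 [(0, 15), (1, 18), (2, 19), (3, 20), (4, 11)] (by decide)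
  simp only [List.map_cons, List.map_nil, List.sum_cons, List.sum_nil, haM, htN]
    at h4 h5 h6 h7 h8 h9 h12 h15
  grind

theorem isLeading_X4Y_Y2 {t : Fin 22 → F} (htN : t 13 = 1) (ht : ∀ j < 13, t j = 0) :
    IsLeading t 6 := by
  refine isLeading_of_relations ht fun a haM h => ?_
  have h4 := h 4 [(5, 13), (6, 13)] (by decide)
  have h6 := h 6 [(4, 13), (5, 15), (6, 15)] (by decide)
  have h7 := h 7 [(3, 13), (4, 15), (5, 16), (6, 16)] (by decide)
  have h9 := h 9 [(2, 13), (3, 15), (4, 16), (5, 18), (6, 18)] (by decide)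
  have h10 := h 10 [(1, 13), (2, 15), (3, 16), (4, 18), (5, 19), (6, 19)] (by decide)
  have h13 := h 13 [(0, 13), (1, 16), (2, 18), (3, 19), (4, 20)] (by decide)
  have h15 := h 15 [(0, 15), (1, 18), (2, 19), (3, 20), (5, 21), (6, 21), (6, 13)] (by decide)
  simp only [List.map_cons, List.map_nil, List.sum_cons, List.sum_nil, haM, htN]
    at h4 h6 h7 h9 h10 h13 h15
  grind

theorem isLeading_X6_Y {t : Fin 22 → F} (htN : t 14 = 1) (ht : ∀ j < 14, t j = 0) :
    IsLeading t 2 := by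
  refine isLeading_of_relations ht fun a haM h => ?_
  have h10 := h 10 [(2, 15)] (by decide)
  have h11 := h 11 [(1, 14), (2, 16)] (by decide)
  have h12 := h 12 [(1, 15), (2, 16)] (by decide)
  have h16 := h 16 [(0, 16), (1, 19), (2, 20)] (by decide)
  have h20 := h 20 [(0, 20), (1, 21), (2, 14)] (by decide)
  simp only [List.map_cons, List.map_nil, List.sum_cons, List.sum_nil, haM, htN]
    at h10 h11 h12 h16 h20
  grind

theorem isLeading_X6_XY {t : Fin 22 → F} (htN : t 14 = 1) (ht : ∀ j < 14, t j = 0) :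
    IsLeading t 4 := by
  refine isLeading_of_relations ht fun a haM h => ?_
  have h7 := h 7 [(4, 15)] (by decide)
  have h8 := h 8 [(3, 14), (4, 16)] (by decide)
  have h9 := h 9 [(3, 15), (4, 16)] (by decide)
  have h10 := h 10 [(2, 15), (3, 16), (4, 18)] (by decide)
  have h11 := h 11 [(1, 14), (2, 16), (3, 17), (4, 19)] (by decide)
  have h12 := h 12 [(1, 15), (2, 16), (3, 18), (4, 19)] (by decide)
  have h18 := h 18 [(0, 18), (1, 20), (3, 21), (4, 14)] (by decide)
  simp only [List.map_cons, List.map_nil, List.sum_cons, List.sum_nil, haM, htN]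
    at h7 h8 h9 h10 h11 h12 h18
  grind

theorem isLeading_X6_X2Y {t : Fin 22 → F} (htN : t 14 = 1) (ht : ∀ j < 14, t j = 0) :
    IsLeading t 7 := by
  refine isLeading_of_relations ht fun a haM h => ?_
  have h4 := h 4 [(7, 15)] (by decide)
  have h6 := h 6 [(5, 15), (6, 15), (7, 16)] (by decide)
  have h7 := h 7 [(4, 15), (5, 16), (6, 16), (7, 18)] (by decide)
  have h9 := h 9 [(3, 15), (4, 16), (5, 18), (6, 18), (7, 19)] (by decide)
  have h10 := h 10 [(2, 15), (3, 16), (4, 18), (5, 19), (6, 19), (7, 20)] (by decide)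
  have h13 := h 13 [(1, 16), (2, 18), (3, 19), (4, 20), (7, 21)] (by decide)
  have h15 := h 15 [(0, 15), (1, 18), (2, 19), (3, 20), (5, 21), (6, 21), (7, 14)] (by decide)
  simp only [List.map_cons, List.map_nil, List.sum_cons, List.sum_nil, haM, htN]
    at h4 h6 h7 h9 h10 h13 h15
  grind

theorem isLeading_X6_Y2 {t : Fin 22 → F} (htN : t 14 = 1) (ht : ∀ j < 14, t j = 0) :
    IsLeading t 6 := by
  refine isLeading_of_relations ht fun a haM h => ?_
  have h5 := h 5 [(5, 14), (6, 15)] (by decide)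
  have h6 := h 6 [(5, 15), (6, 15)] (by decide)
  have h7 := h 7 [(4, 15), (5, 16), (6, 16)] (by decide)
  have h9 := h 9 [(3, 15), (4, 16), (5, 18), (6, 18)] (by decide)
  have h10 := h 10 [(2, 15), (3, 16), (4, 18), (5, 19), (6, 19)] (by decide)
  have h12 := h 12 [(1, 15), (2, 16), (3, 18), (4, 19), (5, 20), (6, 20)] (by decide)
  have h15 := h 15 [(0, 15), (1, 18), (2, 19), (3, 20), (5, 21), (6, 21)] (by decide)
  have h16 := h 16 [(0, 16), (1, 19), (2, 20), (4, 21), (6, 14)] (by decide)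
  simp only [List.map_cons, List.map_nil, List.sum_cons, List.sum_nil, haM, htN]
    at h5 h6 h7 h9 h10 h12 h15 h16
  grind

theorem isLeading_X5Y_Y2 {t : Fin 22 → F} (htN : t 16 = 1) (ht : ∀ j < 16, t j = 0) :
    IsLeading t 6 := by
  refine isLeading_of_relations ht fun a haM h => ?_
  have h7 := h 7 [(5, 16), (6, 16)] (by decide)
  have h9 := h 9 [(4, 16), (5, 18), (6, 18)] (by decide)
  have h10 := h 10 [(3, 16), (4, 18), (5, 19), (6, 19)] (by decide)
  have h12 := h 12 [(2, 16), (3, 18), (4, 19), (5, 20), (6, 20)] (by decide)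
  have h13 := h 13 [(1, 16), (2, 18), (3, 19), (4, 20)] (by decide)
  have h16 := h 16 [(0, 16), (1, 19), (2, 20), (4, 21)] (by decide)
  have h18 := h 18 [(0, 18), (1, 20), (3, 21), (6, 16)] (by decide)
  simp only [List.map_cons, List.map_nil, List.sum_cons, List.sum_nil, haM, htN]
    at h7 h9 h10 h12 h13 h16 h18
  grind

theorem isLeading_X5Y_XY2 {t : Fin 22 → F} (htN : t 16 = 1) (ht : ∀ j < 16, t j = 0) :
    IsLeading t 9 := by
  refine isLeading_of_relations ht fun a haM h => ?_
  have h4 := h 4 [(8, 16), (9, 16)] (by decide)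
  have h6 := h 6 [(7, 16), (8, 18), (9, 18)] (by decide)
  have h7 := h 7 [(5, 16), (6, 16), (7, 18), (8, 19), (9, 19)] (by decide)
  have h9 := h 9 [(4, 16), (5, 18), (6, 18), (7, 19), (8, 20), (9, 20)] (by decide)
  have h10 := h 10 [(3, 16), (4, 18), (5, 19), (6, 19), (7, 20)] (by decide)
  have h12 := h 12 [(2, 16), (3, 18), (4, 19), (5, 20), (6, 20), (8, 21), (9, 21)] (by decide)
  have h13 := h 13 [(1, 16), (2, 18), (3, 19), (4, 20), (7, 21)] (by decide)
  have h15 := h 15 [(1, 18), (2, 19), (3, 20), (5, 21), (6, 21), (9, 16)] (by decide)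
  simp only [List.map_cons, List.map_nil, List.sum_cons, List.sum_nil, haM, htN]
    at h4 h6 h7 h9 h10 h12 h13 h15
  grind

/-- Here `X^7` reproduces `t 17` only against the constant term, as `X^8 = X` and `X^7 Y = Y` are
small; so `a₀ = 0`. Then `Y · X^6 Y^2 = X^2 Y + X^7` gives `t 17 = 0`. -/
theorem isLeading_X7_Y {t : Fin 22 → F} (htN : t 17 = 1) (ht : ∀ j < 17, t j = 0) :
    IsLeading t 2 := by
  refine isLeading_of_relations ht fun a haM h => ?_
  have h17 := h 17 [(0, 17)] (by decide)
  have h21 := h 21 [(0, 21), (2, 17)] (by decide)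
  simp only [List.map_cons, List.map_nil, List.sum_cons, List.sum_nil, haM, htN]
    at h17 h21
  grind

theorem isLeading_X7_XY {t : Fin 22 → F} (htN : t 17 = 1) (ht : ∀ j < 17, t j = 0) :
    IsLeading t 4 := by
  refine isLeading_of_relations ht fun a haM h => ?_
  have h14 := h 14 [(1, 17), (2, 19)] (by decide)
  have h17 := h 17 [(0, 17)] (by decide)
  have h20 := h 20 [(0, 20), (1, 21), (4, 17)] (by decide)
  have h21 := h 21 [(0, 21), (2, 17)] (by decide)
  simp only [List.map_cons, List.map_nil, List.sum_cons, List.sum_nil, haM, htN]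
    at h14 h17 h20 h21
  grind

theorem isLeading_X7_Y2 {t : Fin 22 → F} (htN : t 17 = 1) (ht : ∀ j < 17, t j = 0) :
    IsLeading t 6 := by
  refine isLeading_of_relations ht fun a haM h => ?_
  have h17 := h 17 [(0, 17)] (by decide)
  have h19 := h 19 [(0, 19), (2, 21), (6, 17)] (by decide)
  have h21 := h 21 [(0, 21), (2, 17)] (by decide)
  simp only [List.map_cons, List.map_nil, List.sum_cons, List.sum_nil, haM, htN]
    at h17 h19 h21
  grind

theorem isLeading_X7_X2Y {t : Fin 22 → F} (htN : t 17 = 1) (ht : ∀ j < 17, t j = 0) :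
    IsLeading t 7 := by
  refine isLeading_of_relations ht fun a haM h => ?_
  have h7 := h 7 [(7, 18)] (by decide)
  have h9 := h 9 [(5, 18), (6, 18), (7, 19)] (by decide)
  have h10 := h 10 [(4, 18), (5, 19), (6, 19), (7, 20)] (by decide)
  have h11 := h 11 [(3, 17), (4, 19), (6, 20)] (by decide)
  have h18 := h 18 [(0, 18), (1, 20), (3, 21), (7, 17)] (by decide)
  simp only [List.map_cons, List.map_nil, List.sum_cons, List.sum_nil, haM, htN]
    at h7 h9 h10 h11 h18
  grind

theorem isLeading_X7_XY2 {t : Fin 22 → F} (htN : t 17 = 1) (ht : ∀ j < 17, t j = 0) :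
    IsLeading t 9 := by
  refine isLeading_of_relations ht fun a haM h => ?_
  have h14 := h 14 [(1, 17), (2, 19), (6, 21)] (by decide)
  have h16 := h 16 [(1, 19), (2, 20), (4, 21), (9, 17)] (by decide)
  have h17 := h 17 [(0, 17)] (by decide)
  have h19 := h 19 [(0, 19), (2, 21), (6, 17)] (by decide)
  have h20 := h 20 [(0, 20), (1, 21), (4, 17), (6, 19)] (by decide)
  have h21 := h 21 [(0, 21), (2, 17)] (by decide)
  simp only [List.map_cons, List.map_nil, List.sum_cons, List.sum_nil, haM, htN]
    at h14 h16 h17 h19 h20 h21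
  grind

theorem isLeading_X7_X3Y {t : Fin 22 → F} (htN : t 17 = 1) (ht : ∀ j < 17, t j = 0) :
    IsLeading t 10 := by
  refine isLeading_of_relations ht fun a haM h => ?_
  have h4 := h 4 [(10, 18)] (by decide)
  have h6 := h 6 [(8, 18), (9, 18), (10, 19)] (by decide)
  have h7 := h 7 [(7, 18), (8, 19), (9, 19), (10, 20)] (by decide)
  have h8 := h 8 [(5, 17), (6, 18), (7, 19), (9, 20)] (by decide)
  have h15 := h 15 [(1, 18), (2, 19), (3, 20), (5, 21), (6, 21), (10, 17)] (by decide)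
  have h17 := h 17 [(0, 17)] (by decide)
  have h19 := h 19 [(0, 19), (2, 21), (6, 17)] (by decide)
  have h21 := h 21 [(0, 21), (2, 17)] (by decide)
  simp only [List.map_cons, List.map_nil, List.sum_cons, List.sum_nil, haM, htN]
    at h4 h6 h7 h8 h15 h17 h19 h21
  grind

theorem isLeading_X6Y_Y2 {t : Fin 22 → F} (htN : t 19 = 1) (ht : ∀ j < 19, t j = 0) :
    IsLeading t 6 := by
  refine isLeading_of_relations ht fun a haM h => ?_
  have h10 := h 10 [(5, 19), (6, 19)] (by decide)
  have h11 := h 11 [(4, 19), (6, 20)] (by decide)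
  have h12 := h 12 [(4, 19), (5, 20), (6, 20)] (by decide)
  have h16 := h 16 [(1, 19), (2, 20), (4, 21)] (by decide)
  have h20 := h 20 [(0, 20), (1, 21), (6, 19)] (by decide)
  simp only [List.map_cons, List.map_nil, List.sum_cons, List.sum_nil, haM, htN]
    at h10 h11 h12 h16 h20
  grind

theorem isLeading_X6Y_XY2 {t : Fin 22 → F} (htN : t 19 = 1) (ht : ∀ j < 19, t j = 0) :
    IsLeading t 9 := by
  refine isLeading_of_relations ht fun a haM h => ?_
  have h7 := h 7 [(8, 19), (9, 19)] (by decide)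
  have h8 := h 8 [(7, 19), (9, 20)] (by decide)
  have h9 := h 9 [(7, 19), (8, 20), (9, 20)] (by decide)
  have h13 := h 13 [(3, 19), (4, 20), (7, 21)] (by decide)
  have h18 := h 18 [(1, 20), (3, 21), (9, 19)] (by decide)
  simp only [List.map_cons, List.map_nil, List.sum_cons, List.sum_nil, haM, htN]
    at h7 h8 h9 h13 h18
  grind

theorem isLeading_X6Y_X2Y2 {t : Fin 22 → F} (htN : t 19 = 1) (ht : ∀ j < 19, t j = 0) :
    IsLeading t 12 := by
  refine isLeading_of_relations ht fun a haM h => ?_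
  have h4 := h 4 [(11, 19), (12, 19)] (by decide)
  have h5 := h 5 [(10, 19), (12, 20)] (by decide)
  have h6 := h 6 [(10, 19), (11, 20), (12, 20)] (by decide)
  have h8 := h 8 [(7, 19), (9, 20), (12, 21)] (by decide)
  have h9 := h 9 [(7, 19), (8, 20), (9, 20), (11, 21), (12, 21)] (by decide)
  have h14 := h 14 [(2, 19), (6, 21)] (by decide)
  have h15 := h 15 [(2, 19), (3, 20), (5, 21), (6, 21), (12, 19)] (by decide)
  simp only [List.map_cons, List.map_nil, List.sum_cons, List.sum_nil, haM, htN]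
    at h4 h5 h6 h8 h9 h14 h15
  grind

/-- The value at `X^3 Y^2` obstructs the elimination: only when it is zero does `h3` give `a 8 = 0`.
The opposite case is covered by `isLeading_X6_X3Y`. -/
theorem isLeading_X6_XY2 {t : Fin 22 → F} (htN : t 14 = 1) (ht : ∀ j < 14, t j = 0)
    (ht' : t 15 = 0) :
    IsLeading t 9 := by
  refine isLeading_of_relations ht fun a haM h => ?_
  have h3 := h 3 [(8, 14), (9, 15)] (by decide)
  have h4 := h 4 [(7, 15), (8, 16), (9, 16)] (by decide)
  have h6 := h 6 [(5, 15), (6, 15), (7, 16), (8, 18), (9, 18)] (by decide)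
  have h7 := h 7 [(4, 15), (5, 16), (6, 16), (7, 18), (8, 19), (9, 19)] (by decide)
  have h9 := h 9 [(3, 15), (4, 16), (5, 18), (6, 18), (7, 19), (8, 20), (9, 20)] (by decide)
  have h12 := h 12 [(1, 15), (2, 16), (3, 18), (4, 19), (5, 20),
    (6, 20), (8, 21), (9, 21)] (by decide)
  have h13 := h 13 [(1, 16), (2, 18), (3, 19), (4, 20), (7, 21), (9, 14)] (by decide)
  simp only [List.map_cons, List.map_nil, List.sum_cons, List.sum_nil, haM, htN]
    at h3 h4 h6 h7 h9 h12 h13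
  grind

/-- Multiplying by `Y` leaves `X^3 Y · Y = X^3 Y^2` as the only surviving term, so the relation
reads `t 15 = 0`. -/
theorem isLeading_X6_X3Y {t : Fin 22 → F} (ht : ∀ j < 14, t j = 0) (ht' : t 15 ≠ 0) :
    IsLeading t 10 := by
  refine isLeading_of_relations ht fun a haM h => ?_
  have h2 := h 2 [(10, 15)] (by decide)
  simp only [List.map_cons, List.map_nil, List.sum_cons, List.sum_nil, haM]
    at h2
  grind

theorem isLeading_X7_X2Y2 {t : Fin 22 → F} (htN : t 17 = 1) (ht : ∀ j < 17, t j = 0)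
    (ht' : t 18 = 0) :
    IsLeading t 12 := by
  refine isLeading_of_relations ht fun a haM h => ?_
  have h3 := h 3 [(11, 17), (12, 18)] (by decide)
  have h4 := h 4 [(10, 18), (11, 19), (12, 19)] (by decide)
  have h6 := h 6 [(8, 18), (9, 18), (10, 19), (11, 20), (12, 20)] (by decide)
  have h9 := h 9 [(5, 18), (6, 18), (7, 19), (8, 20), (9, 20), (11, 21), (12, 21)] (by decide)
  have h13 := h 13 [(2, 18), (3, 19), (4, 20), (7, 21), (12, 17)] (by decide)
  simp only [List.map_cons, List.map_nil, List.sum_cons, List.sum_nil, haM, htN]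
    at h3 h4 h6 h9 h13
  grind

theorem isLeading_X7_X4Y {t : Fin 22 → F} (ht : ∀ j < 17, t j = 0) (ht' : t 18 ≠ 0) :
    IsLeading t 13 := by
  refine isLeading_of_relations ht fun a haM h => ?_
  have h2 := h 2 [(13, 18)] (by decide)
  simp only [List.map_cons, List.map_nil, List.sum_cons, List.sum_nil, haM]
    at h2
  grind

end

/-! ### Bounds from leading indices -/

/-- The indices `M` such that the footprint monomial with index `M` divides that with index `N`. -/
def divisorIndices (N : Fin 22) : Finset (Fin 22) :=
  {M | (monExp M).1 ≤ (monExp N).1 ∧ (monExp M).2 ≤ (monExp N).2}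

/-- Further indices which are leading for all functionals with leading index `N`. -/
def extraIndices (N : Fin 22) : Finset (Fin 22) :=
  match (N : ℕ) with
  | 8 => {2}
  | 11 => {2, 4}
  | 13 => {6}
  | 14 => {2, 4, 6, 7}
  | 16 => {6, 9}
  | 17 => {2, 4, 6, 7, 9, 10}
  | 19 => {6, 9, 12}
  | _ => ∅

section

variable {F : Type*} [Field F] {t : Fin 22 → F} {N M : Fin 22}

theorem isLeading_of_mem_divisorIndices (htN : t N = 1) (ht : ∀ j < N, t j = 0)
    (hM : M ∈ divisorIndices N) : IsLeading t M := by
  have h : ∀ N M : Fin 22, M ∈ divisorIndices N → ∃ K, monExp M + monExp K = monExp N := by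
    decide +kernel
  obtain ⟨K, hK⟩ := h N M hM
  exact isLeading_of_add_eq htN ht hK

variable [CharP F 2]

theorem isLeading_of_mem_extraIndices (htN : t N = 1) (ht : ∀ j < N, t j = 0)
    (hM : M ∈ extraIndices N) : IsLeading t M := by
  fin_cases N <;> simp only [extraIndices, Finset.notMem_empty, Finset.mem_insert,
    Finset.mem_singleton] at hM
  · exact hM ▸ isLeading_X4_Y htN ht
  · rcases hM with rfl | rfl
    exacts [isLeading_X5_Y htN ht, isLeading_X5_XY htN ht]
  · exact hM ▸ isLeading_X4Y_Y2 htN ht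
  · rcases hM with rfl | rfl | rfl | rfl
    exacts [isLeading_X6_Y htN ht, isLeading_X6_XY htN ht, isLeading_X6_Y2 htN ht,
      isLeading_X6_X2Y htN ht]
  · rcases hM with rfl | rfl
    exacts [isLeading_X5Y_Y2 htN ht, isLeading_X5Y_XY2 htN ht]
  · rcases hM with rfl | rfl | rfl | rfl | rfl | rfl
    exacts [isLeading_X7_Y htN ht, isLeading_X7_XY htN ht, isLeading_X7_Y2 htN ht,
      isLeading_X7_X2Y htN ht, isLeading_X7_XY2 htN ht, isLeading_X7_X3Y htN ht]
  · rcases hM with rfl | rfl | rfl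
    exacts [isLeading_X6Y_Y2 htN ht, isLeading_X6Y_XY2 htN ht, isLeading_X6Y_X2Y2 htN ht]

theorem isLeading_of_mem_union (htN : t N = 1) (ht : ∀ j < N, t j = 0) :
    ∀ M ∈ divisorIndices N ∪ extraIndices N, IsLeading t M := by
  intro M hM
  rcases Finset.mem_union.1 hM with hM | hM
  exacts [isLeading_of_mem_divisorIndices htN ht hM, isLeading_of_mem_extraIndices htN ht hM]

theorem mu_le_card_union : ∀ N : Fin 22, N ≠ 14 → N ≠ 17 →
    mu N ≤ (divisorIndices N ∪ extraIndices N).card := by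
  decide +kernel

/-- Allowing `S` to depend on `t` gains one index for `X^6` and for `X^7`: either value of the case
distinction supplies one, but not the same one. -/
theorem exists_forall_isLeading (htN : t N = 1) (ht : ∀ j < N, t j = 0) :
    ∃ S : Finset (Fin 22), mu N ≤ S.card ∧ ∀ M ∈ S, IsLeading t M := by
  have hU := isLeading_of_mem_union htN ht
  by_cases h14 : N = 14
  · subst h14
    by_cases h15 : t 15 = 0
    · refine ⟨insert 9 (divisorIndices 14 ∪ extraIndices 14), by decide +kernel, ?_⟩
      exact Finset.forall_mem_insert _ _ _ |>.2 ⟨isLeading_X6_XY2 htN ht h15, hU⟩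
    · refine ⟨insert 10 (divisorIndices 14 ∪ extraIndices 14), by decide +kernel, ?_⟩
      exact Finset.forall_mem_insert _ _ _ |>.2 ⟨isLeading_X6_X3Y ht h15, hU⟩
  by_cases h17 : N = 17
  · subst h17
    by_cases h18 : t 18 = 0
    · refine ⟨insert 12 (divisorIndices 17 ∪ extraIndices 17), by decide +kernel, ?_⟩
      exact Finset.forall_mem_insert _ _ _ |>.2 ⟨isLeading_X7_X2Y2 htN ht h18, hU⟩
    · refine ⟨insert 13 (divisorIndices 17 ∪ extraIndices 17), by decide +kernel, ?_⟩
      exact Finset.forall_mem_insert _ _ _ |>.2 ⟨isLeading_X7_X4Y ht h18, hU⟩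
  exact ⟨_, mu_le_card_union N h14 h17, hU⟩

end

section

/-! ### Syndromes, and the dimension and distance of the dual codes -/

variable {F : Type*} [Field F] [Fintype F]

variable (F) in
/-- The linear map sending a word to its inner products with the evaluated footprint monomials. -/
noncomputable def syndrome :
    (AffineVarietyCode.affineVariety (ideal F) → F) →ₗ[F] (Fin 22 → F) :=
  LinearMap.pi fun b =>
    ∑ P, AffineVarietyCode.ev (ideal F) (monomial (mon b) 1) P • LinearMap.proj P

theorem syndrome_apply (c : AffineVarietyCode.affineVariety (ideal F) → F) (b : Fin 22) :
    syndrome F c b = ∑ P, c P * AffineVarietyCode.ev (ideal F) (monomial (mon b) 1) P := by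
  simp [syndrome, mul_comm]

theorem mem_dualCode_iff (c : AffineVarietyCode.affineVariety (ideal F) → F)
    (S : Set (Fin 22)) : c ∈ AffineVarietyCode.dualCode (ideal F) (mon '' S) ↔
      ∀ b ∈ S, syndrome F c b = 0 := by
  simp only [syndrome_apply]
  constructor
  · intro h b hb
    exact h _ (Submodule.subset_span ⟨_, ⟨b, hb, rfl⟩, rfl⟩)
  · intro h w hw
    refine Submodule.span_induction (p := fun w _ => ∑ P, c P * w P = 0) ?_ (by simp)
      (fun x y _ _ hx hy => by simp [mul_add, Finset.sum_add_distrib, hx, hy])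
      (fun a x _ hx => by simp [mul_left_comm, ← Finset.mul_sum, hx]) hw
    rintro _ ⟨_, ⟨b, hb, rfl⟩, rfl⟩
    exact h b hb

variable [Fact (Fintype.card F = 8)]

theorem card_le_ncard_Lam (N : Fin 22) : (divisorIndices N ∪ extraIndices N).card ≤
    (AffineVarietyCode.Lam order (ideal F) (mon N)).ncard := by
  have := charP_two F
  rw [← Set.ncard_coe_finset, ← Set.ncard_image_of_injective _ mon_injective]
  refine Set.ncard_le_ncard ?_ ((Set.finite_range mon).subset fun M hM => ?_)
  · rintro _ ⟨M, hM, rfl⟩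
    exact mon_mem_Lam fun t htN ht => isLeading_of_mem_union htN ht M hM
  · rw [range_mon_eq_footprint (F := F)]
    exact hM.1

theorem mu_le_weight {c : AffineVarietyCode.affineVariety (ideal F) → F} {i : Fin 22}
    (h : ∀ j < i, syndrome F c j = 0) (hi : syndrome F c i ≠ 0) :
    mu i ≤ AffineVarietyCode.weight c := by
  have := charP_two F
  obtain ⟨S, hS, hlead⟩ := exists_forall_isLeading
    (t := fun b => (syndrome F c i)⁻¹ * syndrome F c b) (inv_mul_cancel₀ hi)
    (fun j hj => by rw [h j hj, mul_zero])
  exact hS.trans (card_le_weight (fun b => by rw [syndrome_apply c b]) hlead)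

/-- A word with zero syndrome is orthogonal to a basis of the space of words, and the standard form
is nondegenerate. -/
theorem syndrome_injective : Function.Injective (syndrome F) := by
  classical
  rw [← LinearMap.ker_eq_bot, LinearMap.ker_eq_bot']
  intro c hc
  have h (w : AffineVarietyCode.affineVariety (ideal F) → F) : ∑ P, c P * w P = 0 := by
    rw [← (evBasis F).sum_repr w]
    simp only [Finset.sum_apply, Pi.smul_apply, smul_eq_mul, Finset.mul_sum]
    rw [Finset.sum_comm]
    refine Finset.sum_eq_zero fun b _ => ?_
    rw [Finset.sum_congr rfl fun P _ => mul_left_comm _ _ _, ← Finset.mul_sum, evBasis_apply,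
      ← syndrome_apply, hc, Pi.zero_apply, mul_zero]
  ext P
  simpa [Pi.single_apply] using h (Pi.single P 1)

/-- The syndrome map is an isomorphism onto `Fin 22 → F` that carries the dual code to the vectors
vanishing on `S`. -/
theorem finrank_dualCode (S : Finset (Fin 22)) :
    Module.finrank F (AffineVarietyCode.dualCode (ideal F) (mon '' (S : Set (Fin 22)))) =
      22 - S.card := by
  classical
  let e := LinearEquiv.ofInjectiveOfFinrankEq (syndrome F) syndrome_injective
    (by simp only [Module.finrank_fintype_fun_eq_card, card_affineVariety, Fintype.card_fin])
  let U : Submodule F (Fin 22 → F) := ⨅ i ∈ (S : Set (Fin 22)), LinearMap.ker (LinearMap.proj i)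
  have hU : AffineVarietyCode.dualCode (ideal F) (mon '' (S : Set (Fin 22))) =
      U.comap e.toLinearMap := by
    ext c
    rw [mem_dualCode_iff]
    simp [U, e]
  rw [hU, (e.ofSubmodule' U).finrank_eq,
    (LinearMap.iInfKerProjEquiv F (fun _ => F) (I := ((Sᶜ : Finset (Fin 22)) : Set (Fin 22)))
      (J := S) (by rw [Finset.coe_compl]; exact disjoint_compl_left)
      (by rw [Finset.coe_compl, Set.compl_union_self])).finrank_eq,
    Module.finrank_fintype_fun_eq_card]
  exact (Fintype.card_coe Sᶜ).trans (by rw [Finset.card_compl, Fintype.card_fin])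

/-- The first nonzero syndrome of `c` has an index `i` with `d ≤ mu i`, since all syndromes with
smaller `mu` vanish. -/
theorem le_weight_of_mem_codeCtilde {d : ℕ}
    {c : AffineVarietyCode.affineVariety (ideal F) → F} (hc : c ∈ codeCtilde F d)
    (h0 : c ≠ 0) : d ≤ AffineVarietyCode.weight c := by
  rw [codeCtilde, mem_dualCode_iff] at hc
  have hne : ∃ b, syndrome F c b ≠ 0 := by
    by_contra! h
    exact h0 (syndrome_injective ((funext h).trans (map_zero (syndrome F)).symm))
  obtain ⟨i, hi, hmin⟩ := WellFounded.has_min (wellFounded_lt (α := Fin 22)) _ hne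
  refine le_trans ?_ (mu_le_weight (fun j hj => by_contra fun h => hmin j h hj) hi)
  exact not_lt.1 fun h => hi (hc i h)

end

/-! ### Words of minimum weight -/

/-- The coefficient of `α^k` in the remainder of `α^n` modulo `α^3 - α - 1`, where `α^7 = 1`. -/
def powDigit (k n : ℕ) : ℕ :=
  ([[1, 0, 0, 1, 0, 1, 1], [0, 1, 0, 1, 1, 1, 0], [0, 0, 1, 0, 1, 1, 1]].getD k []).getD (n % 7) 0

/-- The exponents of `α` in the terms of the inner product of the `b`-th footprint monomial with
the word having the entry `α^e` at the point `(α^i, α^(2^s + 5 i))` for each `(i, s, e)` in `l`. -/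
def syndromeExponents (l : List (ℕ × ℕ × ℕ)) (b : Fin 22) : List ℕ :=
  l.map fun p => p.2.2 + (p.1 * (monExp b).1 + (2 ^ p.2.1 + 5 * p.1) * (monExp b).2)

/-- The sums of the digits of the powers of `α` with the given exponents, modulo two. -/
def digitSums (ns : List ℕ) : List ℕ :=
  [0, 1, 2].map fun k => (ns.map (powDigit k)).sum % 2

section

variable {F : Type*} [Field F] [Fintype F] {α : F}

/-- The word having the entry `α^e` at the point `(α^i, α^(2^s + 5 i))` for each `(i, s, e)` in
`l`, and zeros elsewhere. -/
noncomputable def sparseWord (α : F) (l : List (ℕ × ℕ × ℕ)) :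
    AffineVarietyCode.affineVariety (ideal F) → F :=
  fun P => by
    classical
    exact (l.map fun p => if P.1 = curvePoint α p.1 p.2.1 then α ^ p.2.2 else 0).sum

theorem weight_sparseWord_le (l : List (ℕ × ℕ × ℕ)) :
    AffineVarietyCode.weight (sparseWord α l) ≤ l.length := by
  classical
  have h : Finset.univ.filter (fun P => sparseWord α l P ≠ 0) ⊆
      ((l.map fun p => curvePoint α p.1 p.2.1).toFinset.subtype
        (· ∈ AffineVarietyCode.affineVariety (ideal F))) := by
    intro P hP
    rw [Finset.mem_filter] at hP
    rw [Finset.mem_subtype, List.mem_toFinset, List.mem_map]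
    by_contra! hne
    refine hP.2 (List.sum_eq_zero fun y hy => ?_)
    obtain ⟨p, hp, rfl⟩ := List.mem_map.1 hy
    exact if_neg (hne p hp).symm
  calc AffineVarietyCode.weight (sparseWord α l)
      = (Finset.univ.filter (fun P => sparseWord α l P ≠ 0)).card := by
        unfold AffineVarietyCode.weight hammingNorm
        congr!
    _ ≤ _ := Finset.card_le_card h
    _ ≤ _ := (Finset.card_subtype _ _).trans_le (Finset.card_filter_le _ _)
    _ ≤ _ := List.toFinset_card_le _
    _ = l.length := List.length_map _

variable [Fact (Fintype.card F = 8)]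

theorem sum_sparseWord_mul (hα : α ^ 3 = α + 1) (l : List (ℕ × ℕ × ℕ))
    (f : (Fin 2 → F) → F) : ∑ P, sparseWord α l P * f P.1 =
      (l.map fun p => α ^ p.2.2 * f (curvePoint α p.1 p.2.1)).sum := by
  classical
  induction l with
  | nil => simp [sparseWord]
  | cons p l ih =>
    rw [List.map_cons, List.sum_cons, ← ih]
    simp only [sparseWord, List.map_cons, List.sum_cons, add_mul, Finset.sum_add_distrib]
    congr 1
    rw [Finset.sum_eq_single ⟨_, curvePoint_mem hα p.1 p.2.1⟩]
    · rw [if_pos rfl]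
    · intro P _ hP
      rw [if_neg fun h => hP (Subtype.ext h), zero_mul]
    · simp

theorem pow_eq_powDigit (hα : α ^ 3 = α + 1) (n : ℕ) :
    α ^ n = powDigit 0 n + powDigit 1 n * α + powDigit 2 n * α ^ 2 := by
  have := charP_two F
  have h2 := CharTwo.two_eq_zero (R := F)
  have h7 := pow_seven_eq_one (ne_zero_of_pow_three_eq hα)
  have h (r : ℕ) (hr : r < 7) :
      α ^ r = powDigit 0 r + powDigit 1 r * α + powDigit 2 r * α ^ 2 := by
    interval_cases r <;> simp [powDigit] <;> grind
  have hn : α ^ n = α ^ (n % 7) := by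
    conv_lhs => rw [← Nat.mod_add_div n 7, pow_add, pow_mul, h7, one_pow, mul_one]
  rw [hn, h _ (Nat.mod_lt _ (by norm_num))]
  simp [powDigit]

/-- Sums of powers of `α` in the abstract field become sums of digits modulo two, which the kernel
can evaluate. -/
theorem sum_pow_eq (hα : α ^ 3 = α + 1) {ns : List ℕ} {x y z : ℕ}
    (h : digitSums ns = [x, y, z]) : (ns.map (α ^ ·)).sum = x + y * α + z * α ^ 2 := by
  have := charP_two F
  simp only [digitSums, List.map_cons, List.map_nil, List.cons.injEq, and_true] at h
  obtain ⟨rfl, rfl, rfl⟩ := h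
  rw [← CharP.cast_eq_mod F 2, ← CharP.cast_eq_mod F 2, ← CharP.cast_eq_mod F 2]
  induction ns with
  | nil => simp
  | cons n ns ih =>
    simp only [List.map_cons, List.sum_cons, Nat.cast_add]
    rw [ih, pow_eq_powDigit hα n]
    ring

theorem syndrome_sparseWord (hα : α ^ 3 = α + 1) {l : List (ℕ × ℕ × ℕ)} {b : Fin 22}
    {x y z : ℕ} (h : digitSums (syndromeExponents l b) = [x, y, z]) :
    syndrome F (sparseWord α l) b = x + y * α + z * α ^ 2 := by
  rw [← sum_pow_eq hα h, syndrome_apply, syndromeExponents, List.map_map]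
  refine (sum_sparseWord_mul hα l fun P => aeval P (monomial (mon b) 1)).trans ?_
  congr 1
  refine List.map_congr_left fun p _ => ?_
  rw [mon_eq_expo, aeval_monomial, Finsupp.prod_fintype _ _ (by simp)]
  simp [curvePoint, pow_add, pow_mul]

theorem hasParameters_codeCtilde {k d : ℕ} (l : List (ℕ × ℕ × ℕ))
    (hk : 22 - (Finset.univ.filter fun i => mu i < d).card = k) (hl : l.length = d)
    (h0 : ∀ b, mu b < d → digitSums (syndromeExponents l b) = [0, 0, 0])
    (h1 : ∃ b, digitSums (syndromeExponents l b) = [1, 0, 0]) :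
    AffineVarietyCode.HasParameters (codeCtilde F d) 22 k d := by
  obtain ⟨α, hα⟩ := exists_pow_three_eq F
  have hmem : sparseWord α l ∈ codeCtilde F d := by
    rw [codeCtilde, mem_dualCode_iff]
    intro b hb
    simpa using syndrome_sparseWord hα (h0 b hb)
  have hne : sparseWord α l ≠ 0 := by
    -- One syndrome equal to 1 shows that the word is nonzero; the lower bound then makes its weight
    -- exactly `l.length`.
    obtain ⟨b, hb⟩ := h1
    have h := syndrome_sparseWord hα hb
    intro hz
    rw [hz] at h
    simp at h
  refine ⟨card_affineVariety F, ?_, ⟨_, hmem, hne, ?_⟩, ?_⟩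
  · have hS : ((Finset.univ.filter fun i => mu i < d : Finset (Fin 22)) : Set (Fin 22)) =
        {i | mu i < d} := by ext; simp
    rw [← hk, ← finrank_dualCode (F := F), hS, codeCtilde]
  · exact le_antisymm ((weight_sparseWord_le l).trans_eq hl) (le_weight_of_mem_codeCtilde hmem hne)
  · rintro _ ⟨c, hc, hc0, rfl⟩
    exact le_weight_of_mem_codeCtilde hc hc0

/-- In every case the index supplied for the syndrome 1 has `mu` equal to `d`, so the bound is
attained there. The words for `d = 9, 15, 18, 21` are supported on full fibres of three points over
3, 5, 6, 7 nonzero values of `X`. -/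
theorem hasParameters_of_mem_params : ∀ p ∈ params,
    AffineVarietyCode.HasParameters (codeCtilde F p.2) 22 p.1 p.2 := by
  simp only [params, List.forall_mem_cons, List.not_mem_nil, false_imp_iff, implies_true,
    and_true]
  refine ⟨?_, ?_, ?_, ?_, ?_, ?_, ?_, ?_, ?_, ?_, ?_, ?_, ?_⟩
  · exact hasParameters_codeCtilde [(5, 2, 6), (6, 2, 6)]
      (by decide +kernel) rfl (by decide +kernel) ⟨1, by decide +kernel⟩
  · exact hasParameters_codeCtilde [(1, 2, 2), (3, 2, 3), (6, 1, 5)]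
      (by decide +kernel) rfl (by decide +kernel) ⟨3, by decide +kernel⟩
  · exact hasParameters_codeCtilde [(0, 2, 5), (1, 0, 2), (3, 0, 0), (4, 0, 1)]
      (by decide +kernel) rfl (by decide +kernel) ⟨5, by decide +kernel⟩
  · exact hasParameters_codeCtilde [(0, 1, 5), (1, 1, 6), (2, 1, 1), (3, 1, 6), (3, 2, 3),
      (5, 2, 4)]
      (by decide +kernel) rfl (by decide +kernel) ⟨7, by decide +kernel⟩
  · exact hasParameters_codeCtilde [(0, 1, 2), (0, 2, 2), (1, 0, 2), (1, 2, 2), (2, 0, 6),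
      (2, 2, 6), (6, 0, 3), (6, 2, 3)]
      (by decide +kernel) rfl (by decide +kernel) ⟨10, by decide +kernel⟩
  · exact hasParameters_codeCtilde [(0, 0, 6), (0, 1, 0), (0, 2, 2), (1, 0, 5), (1, 1, 6),
      (1, 2, 1), (2, 0, 6), (2, 1, 0), (2, 2, 2)]
      (by decide +kernel) rfl (by decide +kernel) ⟨12, by decide +kernel⟩
  · exact hasParameters_codeCtilde [(0, 1, 2), (0, 2, 2), (1, 0, 1), (1, 1, 3), (1, 2, 0),
      (3, 0, 5), (3, 1, 5), (4, 1, 5), (4, 2, 5), (6, 1, 4), (6, 2, 4)]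
      (by decide +kernel) rfl (by decide +kernel) ⟨13, by decide +kernel⟩
  · exact hasParameters_codeCtilde [(0, 0, 0), (1, 0, 1), (2, 0, 0), (2, 1, 6), (3, 1, 5),
      (3, 2, 2), (4, 2, 4), (5, 0, 1), (5, 1, 0), (5, 2, 2), (6, 1, 3), (6, 2, 4)]
      (by decide +kernel) rfl (by decide +kernel) ⟨14, by decide +kernel⟩
  · exact hasParameters_codeCtilde [(0, 0, 6), (0, 1, 6), (2, 0, 6), (2, 1, 6), (3, 0, 5),
      (3, 1, 5), (4, 0, 2), (4, 1, 4), (4, 2, 1), (5, 0, 5), (5, 2, 5), (6, 0, 6), (6, 1, 3),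
      (6, 2, 4)]
      (by decide +kernel) rfl (by decide +kernel) ⟨16, by decide +kernel⟩
  · exact hasParameters_codeCtilde [(0, 0, 5), (0, 1, 6), (0, 2, 1), (1, 0, 5), (1, 1, 6),
      (1, 2, 1), (3, 0, 6), (3, 1, 0), (3, 2, 2), (5, 0, 1), (5, 1, 2), (5, 2, 4), (6, 0, 6),
      (6, 1, 0), (6, 2, 2)]
      (by decide +kernel) rfl (by decide +kernel) ⟨18, by decide +kernel⟩
  · exact hasParameters_codeCtilde [(0, 0, 3), (0, 1, 3), (1, 0, 5), (1, 1, 0), (1, 2, 4),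
      (2, 0, 4), (2, 2, 4), (3, 0, 6), (3, 1, 3), (3, 2, 4), (4, 0, 1), (4, 1, 1), (5, 0, 2),
      (5, 1, 1), (5, 2, 4), (6, 0, 0), (6, 1, 0)]
      (by decide +kernel) rfl (by decide +kernel) ⟨19, by decide +kernel⟩
  · exact hasParameters_codeCtilde [(0, 0, 2), (0, 1, 3), (0, 2, 5), (1, 0, 6), (1, 1, 0),
      (1, 2, 2), (2, 0, 2), (2, 1, 3), (2, 2, 5), (4, 0, 6), (4, 1, 0), (4, 2, 2), (5, 0, 0),
      (5, 1, 1), (5, 2, 3), (6, 0, 0), (6, 1, 1), (6, 2, 3)]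
      (by decide +kernel) rfl (by decide +kernel) ⟨20, by decide +kernel⟩
  · exact hasParameters_codeCtilde [(0, 0, 1), (0, 1, 2), (0, 2, 4), (1, 0, 6), (1, 1, 0),
      (1, 2, 2), (2, 0, 4), (2, 1, 5), (2, 2, 0), (3, 0, 2), (3, 1, 3), (3, 2, 5), (4, 0, 0),
      (4, 1, 1), (4, 2, 3), (5, 0, 5), (5, 1, 6), (5, 2, 1), (6, 0, 3), (6, 1, 4), (6, 2, 6)]
      (by decide +kernel) rfl (by decide +kernel) ⟨21, by decide +kernel⟩

end

end KleinQuartic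

theorem mainTheorem5 (F : Type*) [Field F] [Fintype F] (hF : Fintype.card F = 8) :
    -- `M_1, …, M_22` is the footprint of `I_8`, listed in increasing order
    (StrictMono (fun i => KleinQuartic.order.toSyn (KleinQuartic.mon i)) ∧
      Set.range KleinQuartic.mon =
        AffineVarietyCode.footprint KleinQuartic.order
          (AffineVarietyCode.fieldIdeal (KleinQuartic.ideal F))) ∧
    -- `μ(M_i)` is a lower bound for the size of `Λ(M_i)`, with two exceptions
    ((∀ i : Fin 22, i ≠ 14 → i ≠ 17 →
        KleinQuartic.mu i ≤ (AffineVarietyCode.Lam KleinQuartic.order (KleinQuartic.ideal F)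
          (KleinQuartic.mon i)).ncard) ∧
      11 ≤ (AffineVarietyCode.Lam KleinQuartic.order (KleinQuartic.ideal F)
          (KleinQuartic.mon 14)).ncard ∧
      14 ≤ (AffineVarietyCode.Lam KleinQuartic.order (KleinQuartic.ideal F)
          (KleinQuartic.mon 17)).ncard) ∧
    -- `μ(M_i)` is a lower bound for the relative distance `d(C(i-1), C(i))`, for all `i`
    (∀ i : Fin 22, ∀ c ∈ KleinQuartic.codeC F i, c ∉ KleinQuartic.codeC F (i + 1) →
      KleinQuartic.mu i ≤ AffineVarietyCode.weight c) ∧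
    -- the parameters of the codes `C̃(δ)`
    (∀ p ∈ KleinQuartic.params,
      AffineVarietyCode.HasParameters (KleinQuartic.codeCtilde F p.2) 22 p.1 p.2) ∧
    -- comparison with the parameters of Kolluru, Feng and Rao
    ((∀ p ∈ KleinQuartic.kfrParams, ∃ r ∈ KleinQuartic.params, p.1 ≤ r.1 ∧ p.2 ≤ r.2 ∧
        (p ∉ KleinQuartic.params → p.1 < r.1 ∨ p.2 < r.2)) ∧
      (∀ r ∈ [(12, 8), (10, 9), (9, 11), (8, 12), (6, 14), (5, 15), (3, 17)],
        r ∈ KleinQuartic.params ∧ ∀ p ∈ KleinQuartic.kfrParams, ¬ (r.1 ≤ p.1 ∧ r.2 ≤ p.2))) := by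
  have : Fact (Fintype.card F = 8) := ⟨hF⟩
  refine ⟨⟨KleinQuartic.mon_strictMono, KleinQuartic.range_mon_eq_footprint⟩,
    ⟨fun i h14 h17 => (KleinQuartic.mu_le_card_union i h14 h17).trans
      (KleinQuartic.card_le_ncard_Lam i), ?_, ?_⟩, ?_,
    KleinQuartic.hasParameters_of_mem_params, by decide, by decide⟩
  -- `X^6` has 7 divisors and 4 extra indices, `X^7` has 8 and 6: each total is one less than `mu`.
  · exact le_trans (by decide +kernel) (KleinQuartic.card_le_ncard_Lam 14)
  · exact le_trans (by decide +kernel) (KleinQuartic.card_le_ncard_Lam 17)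
  · intro i c hc hc'
    rw [KleinQuartic.codeC, KleinQuartic.mem_dualCode_iff] at hc hc'
    refine KleinQuartic.mu_le_weight (fun j hj => hc j hj) fun hi => hc' fun j hj => ?_
    rcases (Nat.lt_succ_iff.1 hj).lt_or_eq with h | h
    · exact hc j h
    · rwa [Fin.ext h]
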